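/- Let $p\ge 5$ be a prime, let $R_p=\widehat{\mathbb Z}_p^{ur}=W(\overline{\mathbb F}_p)$ with its Frobenius lift $\phi$, let $\pi$ be a root of an Eisenstein polynomial of degree $e\ge 2$ over $\mathbb Z_p$, and let $R_\pi=R_p[\pi]$, with $\phi$ extended to $R_\pi$ by $\phi(\pi)=\pi$. Put $\delta_p x=(\phi(x)-x^p)/p$ on $R_p$ and $\delta_\pi x=(\phi(x)-x^p)/\pi$ on $R_\pi$. Let $X$ be a smooth $R_p$-scheme and $X_{R_\pi}=X\otimes_{R_p}R_\pi$. For $X=\mathrm{Spec}\,A$ affine let $\mathcal O(J^n_p(X))$ (respectively $\mathcal O(J^n_\pi(X_{R_\pi}))$) be the $p$-adic completion of the $n$-th term of the universal $\delta_p$-prolongation sequence of $A$ over $R_p$ (respectively of the universal $\delta_\pi$-prolongation sequence of $A\otimes_{R_p}R_\pi$ over $R_\pi$); that is, if $A=R_p[x]/I$, the completion of $R_p[x,\delta_px,\dots,\delta_p^nx]/(I,\delta_pI,\dots,\delta_p^nI)$, and similarly for $\pi$. For general $X$ these rings are the global functions on the formal schemes glued from the affine pieces. Since $\mathcal O(J_p^\bullet(X))\otimes_{R_p}R_\pi$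 is a $\delta_\pi$-prolongation sequence, universality gives a canonical homomorphism $$\iota_n:\mathcal O(J^n_\pi(X_{R_\pi}))\to \mathcal O(J^n_p(X))\otimes_{R_p}R_\pi .$$ A function $f\in\mathcal O(J^n_p(X))$ is called $\delta_\pi$-overconvergent if $p^\nu f$ is in the image of $\iota_n$ for some integer $\nu\ge 0$. (When $\mathbb Q_p(\pi)/\mathbb Q_p$ is Galois, this is equivalent to: $p^\nu f$ is in the image of $(1\otimes \mathrm{Tr}_{R_\pi/R_p})\circ\iota_n$ for some $\nu\ge 0$.) Let $\partial$ be an $R_p$-derivation of $\mathcal O_X$ and $r\ge 0$. There are unique $R_p$-derivations $\partial_0,\dots,\partial_r$ of $\mathcal O_{J^r_p(X)}$, the conjugate operators of $\partial$, such that on functions on (affine open subsets of) $X$ one has $\partial_j\circ\phi^s=0$ for $s\ne j$ and $\partial_j\circ\phi^j=p^j\cdot\phi^j\circ\partial$, for all $s,j\in\{0,\dots,r\}$. If $f\in\mathcal O(J^r_p(X))$ is $\delta_\pi$-overconvergent, then so are $\partial_jf$ for $j=0,\dots,r$ (with either of the two forms of overconvergence). Moreover, if $r=1$, then the $R_\pi$-linear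 extensions of $\partial_0$ and $\partial_1$ to $\mathcal O(J^1_p(X))\otimes_{R_p}R_\pi$ send the image of $\mathcal O(J^1_\pi(X_{R_\pi}))$ under $\iota_1$ into itself. -/

import Mathlib

set_option linter.unusedSectionVars false

open AlgebraicGeometry
open scoped nonZeroDivisors TensorProduct

noncomputable section

namespace ArithJet

/-! ### The base rings -/

/-- A ring `R` with an element `ϖ` that is not a zero divisor and divides `p`, and with a ring
endomorphism `φ` that lifts the `p`-power Frobenius modulo `ϖ`. The Fermat quotient map of `R` is
`x ↦ (φ x - x ^ p) / ϖ`. Only the two instances below are used. -/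
class FrobeniusBase (p : ℕ) (R : Type*) [CommRing R] where
  phi : R →+* R
  unif : R
  unif_mem : unif ∈ R⁰
  unif_dvd : unif ∣ (p : R)
  dvd_phi_sub : ∀ x, unif ∣ phi x - x ^ p

/-- The completion of the maximal unramified extension of `ℤ_p`: the Witt vectors of an algebraic
closure of `𝔽_p`. -/
abbrev Rp (p : ℕ) [Fact p.Prime] : Type := WittVector p (AlgebraicClosure (ZMod p))

/-- The inclusion of `ℤ_p = W(𝔽_p)` into `Rp p`. -/
def padicToRp (p : ℕ) [Fact p.Prime] : ℤ_[p] →+* Rp p :=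
  (WittVector.map (algebraMap (ZMod p) (AlgebraicClosure (ZMod p)))).comp
    (WittVector.equiv p).symm.toRingHom

theorem frobenius_padicToRp (p : ℕ) [Fact p.Prime] (x : ℤ_[p]) :
    WittVector.frobenius (padicToRp p x) = padicToRp p x := by
  ext n
  simp only [padicToRp, RingHom.comp_apply]
  rw [WittVector.coeff_frobenius_charP, WittVector.map_coeff, ← map_pow]
  simp

instance (p : ℕ) [Fact p.Prime] : FrobeniusBase p (Rp p) where
  phi := WittVector.frobenius
  unif := p
  unif_mem := mem_nonZeroDivisors_of_ne_zero (WittVector.irreducible p).ne_zero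
  unif_dvd := dvd_rfl
  dvd_phi_sub x := by
    rw [← Ideal.mem_span_singleton, WittVector.mem_span_p_iff_coeff_zero_eq_zero]
    change WittVector.constantCoeff (WittVector.frobenius x - x ^ p) = 0
    rw [map_sub, map_pow]
    change (WittVector.frobenius x).coeff 0 - x.coeff 0 ^ p = 0
    rw [WittVector.coeff_frobenius_charP, sub_self]

/-- An Eisenstein polynomial of degree at least two over `ℤ_p`. -/
structure EisensteinPoly (p : ℕ) [Fact p.Prime] where
  poly : Polynomial ℤ_[p]
  monic : poly.Monic
  eisenstein : poly.IsEisensteinAt (Ideal.span {(p : ℤ_[p])})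
  two_le : 2 ≤ poly.natDegree

theorem dvd_phi_sub_add {p : ℕ} [Fact p.Prime] {S T : Type*} [CommRing S] [CommRing T] (f g : S →+* T) {w : T}
    (hw : w ∣ (p : T)) {x y : S} (hx : w ∣ f x - g x ^ p) (hy : w ∣ f y - g y ^ p) :
    w ∣ f (x + y) - g (x + y) ^ p := by
  obtain ⟨r, hr⟩ := exists_add_pow_prime_eq (Fact.out : p.Prime) (g x) (g y)
  rw [map_add, map_add, hr]
  have h3 : w ∣ (p : T) * g x * g y * r := by
    rw [mul_assoc, mul_assoc]; exact hw.mul_right _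
  have := (hx.add hy).sub h3
  convert this using 1; ring

theorem dvd_phi_sub_mul {p : ℕ} {S T : Type*} [CommRing S] [CommRing T] (f g : S →+* T) {w : T}
    {x y : S} (hx : w ∣ f x - g x ^ p) (hy : w ∣ f y - g y ^ p) :
    w ∣ f (x * y) - g (x * y) ^ p := by
  have := (hx.mul_right (f y)).add (hy.mul_left (g x ^ p))
  convert this using 1
  rw [map_mul, map_mul]; ring

section Ramified

open Polynomial

variable {p : ℕ} [Fact p.Prime]

/-- The ring `R_π = R_p[π]`, where `π` is a root of the given Eisenstein polynomial. -/
abbrev Rpi (E : EisensteinPoly p) : Type := AdjoinRoot (E.poly.map (padicToRp p))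

namespace Rpi

variable (E : EisensteinPoly p)

/-- The uniformizer `π`. -/
def pi : Rpi E := AdjoinRoot.root _

/-- The endomorphism of `R_π` that extends the Frobenius of `R_p` and fixes `π`. -/
def phi : Rpi E →+* Rpi E :=
  AdjoinRoot.lift ((AdjoinRoot.of _).comp WittVector.frobenius) (pi E) (by
    rw [eval₂_map, RingHom.comp_assoc]
    have : (WittVector.frobenius : Rp p →+* Rp p).comp (padicToRp p) = padicToRp p :=
      RingHom.ext (frobenius_padicToRp p)
    rw [this, ← eval₂_map]
    exact AdjoinRoot.eval₂_root _)

theorem phi_algebraMap (x : Rp p) :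
    phi E (algebraMap (Rp p) (Rpi E) x) = algebraMap (Rp p) (Rpi E) (FrobeniusBase.phi p x) :=
  AdjoinRoot.lift_of _

theorem phi_pi : phi E (pi E) = pi E := AdjoinRoot.lift_root _

theorem exists_coeff_zero : ∃ u : ℤ_[p]ˣ, E.poly.coeff 0 = p * u := by
  have h := E.eisenstein.mem (n := 0) (by have := E.two_le; omega)
  obtain ⟨u, hu⟩ := Ideal.mem_span_singleton.1 h
  have hun : IsUnit u := by
    by_contra hn
    have : u ∈ IsLocalRing.maximalIdeal ℤ_[p] := hn
    rw [PadicInt.maximalIdeal_eq_span_p] at this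
    apply E.eisenstein.notMem
    rw [hu, pow_two]
    exact Ideal.mul_mem_mul (Ideal.mem_span_singleton_self _) this
  exact ⟨hun.unit, hu⟩

theorem pi_dvd : pi E ∣ (p : Rpi E) := by
  obtain ⟨u, hu⟩ := exists_coeff_zero E
  set f : ℤ_[p] →+* Rpi E := (AdjoinRoot.of _).comp (padicToRp p) with hf
  have h0 : E.poly.eval₂ f (pi E) = 0 := by
    rw [hf, ← eval₂_map]; exact AdjoinRoot.eval₂_root _
  have h2 := congrArg (eval₂ f (pi E)) (divX_mul_X_add E.poly)
  rw [h0, eval₂_add, eval₂_mul, eval₂_X, eval₂_C, hu, map_mul, map_natCast] at h2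
  have h1 : pi E ∣ (p : Rpi E) * f u :=
    ⟨-(E.poly.divX.eval₂ f (pi E)), by linear_combination h2⟩
  exact (Units.dvd_mul_right (u := Units.map (f : ℤ_[p] →* Rpi E) u)).1 h1

theorem pi_mem : pi E ∈ (Rpi E)⁰ := by
  rw [mem_nonZeroDivisors_iff_right]
  intro x hx
  obtain ⟨g, rfl⟩ := AdjoinRoot.mk_surjective x
  rw [pi, ← AdjoinRoot.mk_X, ← map_mul, AdjoinRoot.mk_eq_zero] at hx
  obtain ⟨h, hh⟩ := hx
  have hE : (E.poly.map (padicToRp p)).coeff 0 ≠ 0 := by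
    obtain ⟨u, hu⟩ := exists_coeff_zero E
    rw [coeff_map, hu, map_mul, map_natCast]
    exact mul_ne_zero (WittVector.irreducible p).ne_zero (u.isUnit.map (padicToRp p)).ne_zero
  have h0 : h.coeff 0 = 0 := by
    have := congrArg (fun q => coeff q 0) hh
    simp only [mul_coeff_zero, coeff_X_zero, mul_zero] at this
    exact (mul_eq_zero.1 this.symm).resolve_left hE
  obtain ⟨k, rfl⟩ := X_dvd_iff.2 h0
  rw [AdjoinRoot.mk_eq_zero]
  refine ⟨k, ?_⟩
  have hX : (X : (Rp p)[X]) ≠ 0 := X_ne_zero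
  apply mul_right_cancel₀ hX
  rw [hh]; ring

end Rpi

instance (E : EisensteinPoly p) : FrobeniusBase p (Rpi E) where
  phi := Rpi.phi E
  unif := Rpi.pi E
  unif_mem := Rpi.pi_mem E
  unif_dvd := Rpi.pi_dvd E
  dvd_phi_sub x := by
    have hC : ∀ a : Rp p, Rpi.pi E ∣ Rpi.phi E (AdjoinRoot.of _ a) - (AdjoinRoot.of _ a) ^ p := by
      intro a
      rw [show Rpi.phi E (AdjoinRoot.of _ a) = AdjoinRoot.of _ (WittVector.frobenius a) from
        AdjoinRoot.lift_of _, ← map_pow, ← map_sub]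
      obtain ⟨b, hb⟩ := FrobeniusBase.dvd_phi_sub (p := p) a
      change WittVector.frobenius a - a ^ p = p * b at hb
      rw [hb, map_mul, map_natCast]
      exact (Rpi.pi_dvd E).mul_right _
    have hX : Rpi.pi E ∣ Rpi.phi E (Rpi.pi E) - Rpi.pi E ^ p := by
      rw [Rpi.phi_pi]
      exact dvd_sub dvd_rfl (dvd_pow_self _ (Fact.out : p.Prime).ne_zero)
    obtain ⟨g, rfl⟩ := AdjoinRoot.mk_surjective x
    induction g using Polynomial.induction_on with
    | C a => exact hC a
    | add f g hf hg =>
      rw [map_add]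
      exact dvd_phi_sub_add (Rpi.phi E) (RingHom.id _) (Rpi.pi_dvd E) hf hg
    | monomial n a ih =>
      rw [pow_succ, ← mul_assoc, map_mul]
      exact dvd_phi_sub_mul (Rpi.phi E) (RingHom.id _) ih hX

end Ramified

/-! ### Polynomials in the variables `x, δ x, …, δⁿ x` -/

/-- The ring `R[x, δ x, …, δⁿ x]`, where `x = (x_a)` is a family of variables indexed by `ι`; the
variable `(i, a)` is `δⁱ x_a`. -/
abbrev JetPoly (R : Type*) [CommRing R] (ι : Type*) (n : ℕ) : Type _ :=
  MvPolynomial (Fin (n + 1) × ι) R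

namespace JetPoly

open MvPolynomial

/-- The inclusion `R[x, …, δⁿ x] → R[x, …, δⁿ⁺¹ x]`. -/
def incl (R : Type*) [CommRing R] (ι : Type*) (n : ℕ) :
    JetPoly R ι n →ₐ[R] JetPoly R ι (n + 1) :=
  rename (fun v => (v.1.castSucc, v.2))

section

variable (p : ℕ) {R : Type*} [CommRing R] [FrobeniusBase p R] (ι : Type*)

/-- The ring homomorphism `R[x, …, δⁿ x] → R[x, …, δⁿ⁺¹ x]` that is `φ` on `R` and sends `δⁱ x_a`
to `(δⁱ x_a) ^ p + t * δⁱ⁺¹ x_a`. For `t = ϖ` the symbols `δⁱ x_a` are the iterated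
`ϖ`-derivatives of `x_a`. -/
def frob (t : R) (n : ℕ) : JetPoly R ι n →+* JetPoly R ι (n + 1) :=
  eval₂Hom (C.comp (FrobeniusBase.phi p))
    (fun v => X (v.1.castSucc, v.2) ^ p + C t * X (v.1.succ, v.2))

end

theorem unif_cancel {p : ℕ} {R : Type*} [CommRing R] [FrobeniusBase p R] {σ : Type*} {x y : MvPolynomial σ R}
    (h : C (FrobeniusBase.unif p : R) * x = C (FrobeniusBase.unif p : R) * y) : x = y := by
  ext m
  have := congrArg (coeff m) h
  rw [coeff_C_mul, coeff_C_mul] at this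
  exact (mul_cancel_left_mem_nonZeroDivisors (FrobeniusBase.unif_mem (p := p))).1 this

section

variable {p : ℕ} [Fact p.Prime] {R : Type*} [CommRing R] [FrobeniusBase p R] {ι : Type*}

theorem dvd_frob_sub {t : R} (ht : FrobeniusBase.unif p ∣ t) (n : ℕ) (x : JetPoly R ι n) :
    C (FrobeniusBase.unif p : R) ∣ frob p ι t n x - incl R ι n x ^ p := by
  have hp : C (FrobeniusBase.unif p : R) ∣ ((p : ℕ) : JetPoly R ι (n + 1)) := by
    have := map_dvd (C : R →+* JetPoly R ι (n + 1)) (FrobeniusBase.unif_dvd (p := p) (R := R))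
    rwa [map_natCast] at this
  obtain ⟨g, hg⟩ : ∃ g : JetPoly R ι n →+* JetPoly R ι (n + 1), ∀ x, incl R ι n x = g x :=
    ⟨(incl R ι n).toRingHom, fun _ => rfl⟩
  have hgC : ∀ a, g (C a) = C a := fun a => by rw [← hg]; simp [incl]
  have hgX : ∀ v, g (X v) = X (v.1.castSucc, v.2) := fun v => by rw [← hg]; simp [incl]
  have hfC : ∀ a, frob p ι t n (C a) = C (FrobeniusBase.phi p a) := fun a => by simp [frob]
  have hfX : ∀ v, frob p ι t n (X v) = X (v.1.castSucc, v.2) ^ p + C t * X (v.1.succ, v.2) :=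
    fun v => by simp [frob]
  rw [hg]
  generalize frob p ι t n = f at hfC hfX
  induction x using MvPolynomial.induction_on with
  | C a =>
    rw [hfC, hgC, ← map_pow, ← map_sub]
    exact map_dvd _ (FrobeniusBase.dvd_phi_sub a)
  | add x y hx hy => exact dvd_phi_sub_add f g hp hx hy
  | mul_X x v hx =>
    refine dvd_phi_sub_mul f g hx ?_
    rw [hfX, hgX, add_sub_cancel_left]
    exact (map_dvd _ ht).mul_right _

/-- The `ϖ`-derivation `x ↦ (frob x - x ^ p) / ϖ`. -/
def delta {t : R} (ht : FrobeniusBase.unif p ∣ t) (n : ℕ) (x : JetPoly R ι n) :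
    JetPoly R ι (n + 1) :=
  (dvd_frob_sub ht n x).choose

theorem unif_mul_delta {t : R} (ht : FrobeniusBase.unif p ∣ t) (n : ℕ) (x : JetPoly R ι n) :
    C (FrobeniusBase.unif p : R) * delta ht n x = frob p ι t n x - incl R ι n x ^ p :=
  (dvd_frob_sub ht n x).choose_spec.symm

end

end JetPoly

/-! ### Prolongations and jet algebras -/

section Jets

variable (p : ℕ) [Fact p.Prime] (R : Type*) [CommRing R] [FrobeniusBase p R]

/-- The ideal of relations among `x, δ x, …, δⁿ x` for the tautological generators
`x = (x_b)_{b ∈ B}` of the `R`-algebra `B`: for `n = 0` all relations that hold in `B`, and in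
each further step the old relations together with their `ϖ`-derivatives. -/
def jetIdeal (B : Type*) [CommRing B] [Algebra R B] : ∀ n : ℕ, Ideal (JetPoly R B n)
  | 0 => RingHom.ker (MvPolynomial.aeval (fun v => v.2) : JetPoly R B 0 →ₐ[R] B)
  | n + 1 => Ideal.span
      ((JetPoly.incl R B n '' (jetIdeal B n : Set (JetPoly R B n))) ∪
        (JetPoly.delta (p := p) (dvd_refl (FrobeniusBase.unif p : R)) n ''
          (jetIdeal B n : Set (JetPoly R B n))))

/-- The `n`-th term `Bⁿ` of the universal prolongation sequence of the `R`-algebra `B`. -/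
def JetAlg (B : Type*) [CommRing B] [Algebra R B] (n : ℕ) : Type _ :=
  JetPoly R B n ⧸ jetIdeal p R B n

instance (B : Type*) [CommRing B] [Algebra R B] (n : ℕ) : CommRing (JetAlg p R B n) :=
  inferInstanceAs (CommRing (JetPoly R B n ⧸ jetIdeal p R B n))

instance (B : Type*) [CommRing B] [Algebra R B] (n : ℕ) : Algebra R (JetAlg p R B n) :=
  inferInstanceAs (Algebra R (JetPoly R B n ⧸ jetIdeal p R B n))

/-- The projection `R[x, …, δⁿ x] → Bⁿ`. -/
def JetAlg.mk (B : Type*) [CommRing B] [Algebra R B] (n : ℕ) :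
    JetPoly R B n →ₐ[R] JetAlg p R B n :=
  Ideal.Quotient.mkₐ R (jetIdeal p R B n)

/-- The ring of functions of the `n`-th jet space of `Spec B`: the `p`-adic completion of `Bⁿ`. -/
def JetRing (B : Type*) [CommRing B] [Algebra R B] (n : ℕ) : Type _ :=
  AdicCompletion (Ideal.span {(p : JetAlg p R B n)}) (JetAlg p R B n)

instance (B : Type*) [CommRing B] [Algebra R B] (n : ℕ) : CommRing (JetRing p R B n) :=
  inferInstanceAs (CommRing (AdicCompletion _ (JetAlg p R B n)))

instance (B : Type*) [CommRing B] [Algebra R B] (n : ℕ) : Algebra R (JetRing p R B n) :=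
  inferInstanceAs (Algebra R (AdicCompletion _ (JetAlg p R B n)))

/-- The canonical map `Bⁿ → (Bⁿ)^`. -/
def JetRing.of (B : Type*) [CommRing B] [Algebra R B] (n : ℕ) :
    JetAlg p R B n →ₐ[R] JetRing p R B n where
  toRingHom := algebraMap (JetAlg p R B n) (AdicCompletion _ (JetAlg p R B n))
  commutes' _ := rfl

/-- The element `φˢ b` of `R[x, …, δʳ x]`, for `s ≤ r`. -/
def JetPoly.phiPow {B : Type*} : ∀ r : ℕ, ℕ → B → JetPoly R B r
  | 0, _, b => MvPolynomial.X (0, b)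
  | r + 1, 0, b => JetPoly.incl R B r (JetPoly.phiPow r 0 b)
  | r + 1, s + 1, b =>
    JetPoly.frob p B (FrobeniusBase.unif p : R) r (JetPoly.phiPow r s b)

/-- The map `φˢ : B → O(Jʳ(Spec B))`, for `s ≤ r`. -/
def JetRing.phiPow {B : Type*} [CommRing B] [Algebra R B] (r s : ℕ) (b : B) : JetRing p R B r :=
  JetRing.of p R B r (JetAlg.mk p R B r (JetPoly.phiPow p R r s b))

variable {R}

section Map

variable {B B' : Type*} [CommRing B] [Algebra R B] [CommRing B'] [Algebra R B']

/-- The `R`-algebra homomorphism with `δⁱ x_b ↦ δⁱ x_{h b}`. -/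
def JetPoly.map (h : B →ₐ[R] B') (n : ℕ) : JetPoly R B n →ₐ[R] JetPoly R B' n :=
  MvPolynomial.rename (fun v => (v.1, h v.2))

theorem JetPoly.map_incl (h : B →ₐ[R] B') (n : ℕ) (x : JetPoly R B n) :
    JetPoly.map h (n + 1) (JetPoly.incl R B n x) = JetPoly.incl R B' n (JetPoly.map h n x) := by
  simp only [JetPoly.map, JetPoly.incl, MvPolynomial.rename_rename]
  rfl

theorem JetPoly.map_frob {p : ℕ} {R : Type*} [CommRing R] [FrobeniusBase p R] {B B' : Type*}
    [CommRing B] [Algebra R B] [CommRing B'] [Algebra R B'] (h : B →ₐ[R] B') (t : R) (n : ℕ) (x : JetPoly R B n) :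
    JetPoly.map h (n + 1) (JetPoly.frob p B t n x) =
      JetPoly.frob p B' t n (JetPoly.map h n x) := by
  induction x using MvPolynomial.induction_on with
  | C a => simp [JetPoly.map, JetPoly.frob]
  | add f g hf hg => simp only [map_add, hf, hg]
  | mul_X f v hf =>
    rw [map_mul, map_mul, map_mul, map_mul, hf]
    congr 1
    simp [JetPoly.map, JetPoly.frob]

theorem JetPoly.map_delta (h : B →ₐ[R] B') {t : R} (ht : FrobeniusBase.unif p ∣ t) (n : ℕ)
    (x : JetPoly R B n) :
    JetPoly.map h (n + 1) (JetPoly.delta ht n x) = JetPoly.delta ht n (JetPoly.map h n x) := by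
  apply JetPoly.unif_cancel (p := p)
  rw [JetPoly.unif_mul_delta, ← JetPoly.map_frob, ← JetPoly.map_incl, ← map_pow, ← map_sub,
    ← JetPoly.unif_mul_delta ht, map_mul]
  congr 1
  simp [JetPoly.map]

theorem jetIdeal_map (h : B →ₐ[R] B') (n : ℕ) :
    ∀ x ∈ jetIdeal p R B n, JetPoly.map h n x ∈ jetIdeal p R B' n := by
  induction n with
  | zero =>
    intro x hx
    have key : (MvPolynomial.aeval (fun v => v.2) : JetPoly R B' 0 →ₐ[R] B').comp
        (JetPoly.map h 0) = h.comp (MvPolynomial.aeval (fun v => v.2)) := by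
      ext v; simp [JetPoly.map]
    have hx' : (MvPolynomial.aeval (fun v => v.2) : JetPoly R B 0 →ₐ[R] B) x = 0 := hx
    change (MvPolynomial.aeval (fun v => v.2) : JetPoly R B' 0 →ₐ[R] B') (JetPoly.map h 0 x) = 0
    have := DFunLike.congr_fun key x
    rw [AlgHom.comp_apply, AlgHom.comp_apply, hx', map_zero] at this
    exact this
  | succ n ih =>
    intro x hx
    have : jetIdeal p R B (n + 1) ≤
        (jetIdeal p R B' (n + 1)).comap (JetPoly.map h (n + 1)) := by
      refine Ideal.span_le.2 ?_
      rintro _ (⟨y, hy, rfl⟩ | ⟨y, hy, rfl⟩)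
      · refine Ideal.subset_span (Or.inl ⟨_, ih y hy, ?_⟩)
        exact (JetPoly.map_incl h n y).symm
      · refine Ideal.subset_span (Or.inr ⟨_, ih y hy, ?_⟩)
        exact (JetPoly.map_delta p h _ n y).symm
    exact this hx

/-- Functoriality of `B ↦ Bⁿ`. -/
def JetAlg.map (h : B →ₐ[R] B') (n : ℕ) : JetAlg p R B n →ₐ[R] JetAlg p R B' n :=
  Ideal.quotientMapₐ (jetIdeal p R B' n) (JetPoly.map h n) (jetIdeal_map p h n)

end Map

/-- A ring homomorphism modulo powers of `p`. -/
def modPow {S T : Type*} [CommRing S] [CommRing T] (f : S →+* T) (m : ℕ) :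
    S ⧸ Ideal.span {(p : S)} ^ m →+* T ⧸ Ideal.span {(p : T)} ^ m :=
  Ideal.quotientMap _ f (by
    rw [← Ideal.map_le_iff_le_comap, Ideal.map_pow, Ideal.map_span, Set.image_singleton,
      map_natCast])

theorem factorPow_modPow (p : ℕ) {S T : Type*} [CommRing S] [CommRing T] (f : S →+* T) {m n : ℕ}
    (hle : m ≤ n) (x : AdicCompletion (Ideal.span {(p : S)}) S) :
    Ideal.Quotient.factorPow (Ideal.span {(p : T)}) hle
      (modPow p f n (AdicCompletion.evalₐ (Ideal.span {(p : S)}) n x)) =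
        modPow p f m (AdicCompletion.evalₐ (Ideal.span {(p : S)}) m x) := by
  have h1 : modPow p f m (AdicCompletion.evalₐ (Ideal.span {(p : S)}) m x) =
      modPow p f m (Ideal.Quotient.factorPow (Ideal.span {(p : S)}) hle
        (AdicCompletion.evalₐ (Ideal.span {(p : S)}) n x)) := by
    congr 1
    obtain ⟨y, rfl⟩ := AdicCompletion.mk_surjective _ _ x
    rw [AdicCompletion.evalₐ_mk, AdicCompletion.evalₐ_mk]
    exact (AdicCompletion.Ideal.mk_eq_mk _ hle y).symm
  rw [h1]
  generalize AdicCompletion.evalₐ (Ideal.span {(p : S)}) n x = z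
  obtain ⟨z, rfl⟩ := Ideal.Quotient.mk_surjective z
  rfl

/-- The homomorphism between `p`-adic completions induced by a ring homomorphism. -/
def completionMap {S T : Type*} [CommRing S] [CommRing T] (f : S →+* T) :
    AdicCompletion (Ideal.span {(p : S)}) S →+* AdicCompletion (Ideal.span {(p : T)}) T :=
  AdicCompletion.liftRingHom _
    (fun m => (modPow p f m).comp
      (AdicCompletion.evalₐ (Ideal.span {(p : S)}) m : AdicCompletion _ S →+* _))
    (fun hle => RingHom.ext fun x => factorPow_modPow p f hle x)

/-- The homomorphism induced by `f` on the `p`-adic completion of `S` when `T` is `p`-adically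
complete. -/
def completionLift {S T : Type*} [CommRing S] [CommRing T]
    [IsAdicComplete (Ideal.span {(p : T)}) T] (f : S →+* T) :
    AdicCompletion (Ideal.span {(p : S)}) S →+* T :=
  IsAdicComplete.liftRingHom (Ideal.span {(p : T)})
    (fun m => (modPow p f m).comp
      (AdicCompletion.evalₐ (Ideal.span {(p : S)}) m : AdicCompletion _ S →+* _))
    (fun hle => RingHom.ext fun x => factorPow_modPow p f hle x)

/-- Functoriality of `B ↦ O(Jⁿ(Spec B))`. -/
def JetRing.map {B B' : Type*} [CommRing B] [Algebra R B] [CommRing B'] [Algebra R B']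
    (h : B →ₐ[R] B') (n : ℕ) : JetRing p R B n →+* JetRing p R B' n :=
  completionMap p (JetAlg.map p h n : JetAlg p R B n →+* JetAlg p R B' n)

end Jets

/-! ### The comparison between `π`-jets and `p`-jets -/

/-- An extension `R → R'` of base rings such as `R_p → R_π`: `R'` is free of finite rank over `R`,
the endomorphism `φ` of `R'` extends that of `R`, and the distinguished element of `R` is `p`. -/
class FrobeniusExt (p : ℕ) (R R' : Type*) [CommRing R] [CommRing R'] [Algebra R R']
    [FrobeniusBase p R] [FrobeniusBase p R'] : Prop where
  phi_algebraMap : ∀ x : R, FrobeniusBase.phi p (algebraMap R R' x) =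
    algebraMap R R' (FrobeniusBase.phi p x)
  unif_eq : (FrobeniusBase.unif p : R) = p
  free : Module.Free R R'
  finite : Module.Finite R R'

instance {p : ℕ} [Fact p.Prime] (E : EisensteinPoly p) : FrobeniusExt p (Rp p) (Rpi E) where
  phi_algebraMap := Rpi.phi_algebraMap E
  unif_eq := rfl
  free := (E.monic.map (padicToRp p)).free_adjoinRoot
  finite := (E.monic.map (padicToRp p)).finite_adjoinRoot

section Compare

open JetPoly

variable (p : ℕ) [Fact p.Prime] (R R' : Type*) [CommRing R] [CommRing R'] [Algebra R R']
  [FrobeniusBase p R] [FrobeniusBase p R'] (A : Type*) [CommRing A] [Algebra R A]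

theorem aeval_surjective : Function.Surjective
    (MvPolynomial.aeval (fun v => v.2) : JetPoly R A 0 →ₐ[R] A) :=
  fun a => ⟨MvPolynomial.X (0, a), MvPolynomial.aeval_X _ _⟩

/-- The isomorphism `A⁰ ≃ A`. -/
def JetAlg.zeroEquiv : JetAlg p R A 0 ≃ₐ[R] A :=
  Ideal.quotientKerAlgEquivOfSurjective (aeval_surjective R A)

/-- The projection of `R'[x, δ_p x, …, δ_pⁿ x]` onto `R' ⊗ Aⁿ`, where `Aⁿ` is the `n`-th term of
the universal `δ_p`-prolongation sequence. -/
def mixedProj (n : ℕ) : JetPoly R' A n →ₐ[R'] R' ⊗[R] JetAlg p R A n :=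
  MvPolynomial.aeval (fun v => 1 ⊗ₜ JetAlg.mk p R A n (MvPolynomial.X v))

theorem mixedProj_algebraTensor (n : ℕ) (y : R' ⊗[R] JetPoly R A n) :
    mixedProj p R R' A n (MvPolynomial.algebraTensorAlgEquiv R R' y) =
      Algebra.TensorProduct.map (AlgHom.id R R') (JetAlg.mk p R A n) y := by
  have key : (mixedProj p R R' A n).comp
      (MvPolynomial.algebraTensorAlgEquiv (σ := Fin (n + 1) × A) R R').toAlgHom =
      Algebra.TensorProduct.map (AlgHom.id R' R') (JetAlg.mk p R A n) := by
    ext v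
    simp [mixedProj]
  exact DFunLike.congr_fun key y

theorem mixedProj_surjective (n : ℕ) : Function.Surjective (mixedProj p R R' A n) := by
  intro z
  have hs : Function.Surjective
      (Algebra.TensorProduct.map (AlgHom.id R R') (JetAlg.mk p R A n)) :=
    LinearMap.lTensor_surjective R' (g := (JetAlg.mk p R A n).toLinearMap)
      Ideal.Quotient.mk_surjective
  obtain ⟨y, rfl⟩ := hs z
  exact ⟨_, mixedProj_algebraTensor p R R' A n y⟩

theorem ker_mixedProj (n : ℕ) : RingHom.ker (mixedProj p R R' A n) =
    (jetIdeal p R A n).map (MvPolynomial.map (algebraMap R R')) := by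
  have hmap : ∀ f : JetPoly R A n, MvPolynomial.map (algebraMap R R') f =
      MvPolynomial.algebraTensorAlgEquiv R R' ((1 : R') ⊗ₜ[R] f) := by
    intro f; simp
  have hker : RingHom.ker (JetAlg.mk p R A n) = jetIdeal p R A n := Ideal.mk_ker
  apply le_antisymm
  · intro x hx
    obtain ⟨y, rfl⟩ := (MvPolynomial.algebraTensorAlgEquiv R R').surjective x
    have hy : y ∈ RingHom.ker
        (Algebra.TensorProduct.map (AlgHom.id R R') (JetAlg.mk p R A n)) := by
      rw [RingHom.mem_ker, ← mixedProj_algebraTensor]; exact hx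
    rw [Algebra.TensorProduct.lTensor_ker _ Ideal.Quotient.mk_surjective, hker] at hy
    suffices h : (jetIdeal p R A n).map Algebra.TensorProduct.includeRight ≤
        ((jetIdeal p R A n).map (MvPolynomial.map (algebraMap R R'))).comap
          (MvPolynomial.algebraTensorAlgEquiv (σ := Fin (n + 1) × A) R R') from h hy
    rw [Ideal.map_le_iff_le_comap]
    intro f hf
    rw [Ideal.mem_comap, Ideal.mem_comap, Algebra.TensorProduct.includeRight_apply, ← hmap]
    exact Ideal.mem_map_of_mem _ hf
  · rw [Ideal.map_le_iff_le_comap]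
    intro f hf
    rw [Ideal.mem_comap, RingHom.mem_ker, hmap, mixedProj_algebraTensor]
    rw [← hker, RingHom.mem_ker] at hf
    simp [hf]

variable {p R A}

theorem incl_mixed {R R' : Type*} [CommRing R] [CommRing R'] [Algebra R R'] {A : Type*} (n : ℕ) (f : JetPoly R A n) :
    incl R' A n (MvPolynomial.map (algebraMap R R') f) =
      MvPolynomial.map (algebraMap R R') (incl R A n f) := by
  simp only [incl, MvPolynomial.map_rename]

theorem frob_mixed [FrobeniusExt p R R'] (n : ℕ) (f : JetPoly R A n) :
    frob p A (p : R') n (MvPolynomial.map (algebraMap R R') f) =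
      MvPolynomial.map (algebraMap R R') (frob p A (FrobeniusBase.unif p : R) n f) := by
  induction f using MvPolynomial.induction_on with
  | C a => simp [frob, FrobeniusExt.phi_algebraMap]
  | add f g hf hg => simp only [map_add, hf, hg]
  | mul_X f v hf =>
    rw [map_mul, map_mul, map_mul, map_mul, hf]
    congr 1
    simp [frob, FrobeniusExt.unif_eq (p := p) (R := R) R']

theorem jetIdeal_incl (n : ℕ) {f : JetPoly R A n} (hf : f ∈ jetIdeal p R A n) :
    incl R A n f ∈ jetIdeal p R A (n + 1) :=
  Ideal.subset_span (Or.inl ⟨f, hf, rfl⟩)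

theorem jetIdeal_delta (n : ℕ) {f : JetPoly R A n} (hf : f ∈ jetIdeal p R A n) :
    delta (p := p) (dvd_refl (FrobeniusBase.unif p : R)) n f ∈ jetIdeal p R A (n + 1) :=
  Ideal.subset_span (Or.inr ⟨f, hf, rfl⟩)

theorem ker_mixedProj_incl (n : ℕ) {x : JetPoly R' A n}
    (hx : x ∈ RingHom.ker (mixedProj p R R' A n)) :
    incl R' A n x ∈ RingHom.ker (mixedProj p R R' A (n + 1)) := by
  rw [ker_mixedProj] at hx ⊢
  suffices h : (jetIdeal p R A n).map (MvPolynomial.map (algebraMap R R')) ≤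
      ((jetIdeal p R A (n + 1)).map (MvPolynomial.map (algebraMap R R'))).comap
        (incl R' A n) from h hx
  rw [Ideal.map_le_iff_le_comap]
  intro f hf
  rw [Ideal.mem_comap, Ideal.mem_comap, incl_mixed]
  exact Ideal.mem_map_of_mem _ (jetIdeal_incl n hf)

theorem delta_add_mem {S : Type*} [CommRing S] [FrobeniusBase p S] {ι : Type*} {t : S}
    (ht : FrobeniusBase.unif p ∣ t) (n : ℕ) (I : Ideal (JetPoly S ι (n + 1)))
    {x y : JetPoly S ι n} (hx : delta ht n x ∈ I) (hx' : incl S ι n x ∈ I)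
    (hy : delta ht n y ∈ I) : delta ht n (x + y) ∈ I := by
  obtain ⟨r, hr⟩ := exists_add_pow_prime_eq (Fact.out : p.Prime) (incl S ι n x) (incl S ι n y)
  obtain ⟨c, hc⟩ := FrobeniusBase.unif_dvd (p := p) (R := S)
  have hc' : ((p : ℕ) : JetPoly S ι (n + 1)) =
      MvPolynomial.C (FrobeniusBase.unif p : S) * MvPolynomial.C c := by
    rw [← map_mul, ← hc, map_natCast]
  have : delta ht n (x + y) = delta ht n x + delta ht n y -
      MvPolynomial.C c * incl S ι n y * r * incl S ι n x := by
    apply unif_cancel (p := p)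
    have h1 := unif_mul_delta ht n x
    have h2 := unif_mul_delta ht n y
    have h3 := unif_mul_delta ht n (x + y)
    rw [map_add, map_add, hr, hc'] at h3
    linear_combination h3 - h1 - h2
  rw [this]
  exact I.sub_mem (I.add_mem hx hy) (I.mul_mem_left _ hx')

theorem delta_mul_mem {S : Type*} [CommRing S] [FrobeniusBase p S] {ι : Type*} {t : S}
    (ht : FrobeniusBase.unif p ∣ t) (n : ℕ) (I : Ideal (JetPoly S ι (n + 1)))
    {x y : JetPoly S ι n} (hy : delta ht n y ∈ I) (hy' : incl S ι n y ∈ I) :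
    delta ht n (x * y) ∈ I := by
  have : delta ht n (x * y) = frob p ι t n x * delta ht n y +
      delta ht n x * incl S ι n y ^ p := by
    apply unif_cancel (p := p)
    have h1 := unif_mul_delta ht n x
    have h2 := unif_mul_delta ht n y
    have h3 := unif_mul_delta ht n (x * y)
    rw [map_mul, map_mul] at h3
    linear_combination h3 - frob p ι t n x * h2 - incl S ι n y ^ p * h1
  rw [this]
  exact I.add_mem (I.mul_mem_left _ hy)
    (I.mul_mem_left _ (I.pow_mem_of_mem hy' _ (Fact.out : p.Prime).pos))

theorem ker_mixedProj_delta [FrobeniusExt p R R'] (n : ℕ) {x : JetPoly R' A n}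
    (hx : x ∈ RingHom.ker (mixedProj p R R' A n)) :
    delta (p := p) (FrobeniusBase.unif_dvd (R := R')) n x ∈
      RingHom.ker (mixedProj p R R' A (n + 1)) := by
  rw [ker_mixedProj] at hx
  refine Submodule.span_induction
    (p := fun y _ => delta (p := p) (FrobeniusBase.unif_dvd (R := R')) n y ∈
      RingHom.ker (mixedProj p R R' A (n + 1))) ?_ ?_ ?_ ?_ hx
  · rintro _ ⟨f, hf, rfl⟩
    rw [ker_mixedProj]
    obtain ⟨c, hc⟩ := FrobeniusBase.unif_dvd (p := p) (R := R')
    have : delta (p := p) (FrobeniusBase.unif_dvd (R := R')) n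
        (MvPolynomial.map (algebraMap R R') f) =
        MvPolynomial.C c * MvPolynomial.map (algebraMap R R')
          (delta (p := p) (dvd_refl (FrobeniusBase.unif p : R)) n f) := by
      apply unif_cancel (p := p)
      have h1 := congrArg (MvPolynomial.map (algebraMap R R'))
        (unif_mul_delta (p := p) (dvd_refl (FrobeniusBase.unif p : R)) n f)
      have hu : (MvPolynomial.C (algebraMap R R' (FrobeniusBase.unif p)) : JetPoly R' A (n + 1)) =
          MvPolynomial.C (FrobeniusBase.unif p) * MvPolynomial.C c := by
        rw [FrobeniusExt.unif_eq (p := p) (R := R) R', map_natCast, hc, MvPolynomial.C_mul]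
      rw [map_mul, map_sub, map_pow, MvPolynomial.map_C, hu] at h1
      rw [unif_mul_delta, frob_mixed, incl_mixed, ← mul_assoc, h1]
    rw [this]
    exact Ideal.mul_mem_left _ _ (Ideal.mem_map_of_mem _ (jetIdeal_delta n hf))
  · have h0 : delta (p := p) (FrobeniusBase.unif_dvd (R := R')) n (0 : JetPoly R' A n) = 0 := by
      apply unif_cancel (p := p)
      rw [unif_mul_delta, map_zero, map_zero, zero_pow (Fact.out : p.Prime).ne_zero]
      simp
    rw [h0]; exact Ideal.zero_mem _
  · intro a b ha hb h1 h2
    exact delta_add_mem _ n _ h1 (ker_mixedProj_incl R' n (by rw [ker_mixedProj]; exact ha)) h2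
  · intro a b hb h1
    exact delta_mul_mem _ n _ h1 (ker_mixedProj_incl R' n (by rw [ker_mixedProj]; exact hb))

variable (p R A)

/-- A lift of an element of `R' ⊗ A` to `R'[x]`. -/
def mixedLift (b : R' ⊗[R] A) : JetPoly R' A 0 :=
  Function.surjInv (mixedProj_surjective p R R' A 0)
    (Algebra.TensorProduct.map (AlgHom.id R R')
      ((JetAlg.zeroEquiv p R A).symm : A →ₐ[R] JetAlg p R A 0) b)

/-- The element `δ_πⁱ b` of `R'[x, δ_p x, …, δ_pⁿ x]`, for `i ≤ n`, where `b` is lifted to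
`R'[x]` and `δ_π z = (φ z - z ^ p) / π`. -/
def mixedDeltaPow : ∀ n : ℕ, ℕ → R' ⊗[R] A → JetPoly R' A n
  | 0, _, b => mixedLift p R R' A b
  | n + 1, 0, b => incl R' A n (mixedDeltaPow n 0 b)
  | n + 1, i + 1, b =>
    delta (p := p) (FrobeniusBase.unif_dvd (R := R')) n (mixedDeltaPow n i b)

/-- The map `R'[x_b, δ_π x_b, …, δ_πⁿ x_b] → R'[x, δ_p x, …, δ_pⁿ x]`, with `b ∈ R' ⊗ A`, that
sends `δ_πⁱ x_b` to `δ_πⁱ b`. -/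
def comparePoly (n : ℕ) : JetPoly R' (R' ⊗[R] A) n →ₐ[R'] JetPoly R' A n :=
  MvPolynomial.aeval (fun v => mixedDeltaPow p R R' A n v.1 v.2)

theorem delta_incl {S : Type*} [CommRing S] [FrobeniusBase p S] {ι : Type*} {t : S}
    (ht : FrobeniusBase.unif p ∣ t) (n : ℕ) (x : JetPoly S ι n) :
    delta ht (n + 1) (incl S ι n x) = incl S ι (n + 1) (delta ht n x) := by
  apply unif_cancel (p := p)
  have hfi : frob p ι t (n + 1) (incl S ι n x) = incl S ι (n + 1) (frob p ι t n x) := by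
    induction x using MvPolynomial.induction_on with
    | C a => simp [frob, incl]
    | add f g hf hg => simp only [map_add, hf, hg]
    | mul_X f v hf =>
      rw [map_mul, map_mul, map_mul, map_mul, hf]
      congr 1
      simp [frob, incl]
  rw [unif_mul_delta, hfi, ← map_pow, ← map_sub, ← unif_mul_delta ht, map_mul]
  congr 1
  simp [incl]

theorem mixedDeltaPow_castSucc (n : ℕ) : ∀ (i : ℕ), i ≤ n → ∀ (b : R' ⊗[R] A),
    mixedDeltaPow p R R' A (n + 1) i b = incl R' A n (mixedDeltaPow p R R' A n i b) := by
  induction n with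
  | zero =>
    intro i hi b
    obtain rfl : i = 0 := by omega
    rfl
  | succ n ih =>
    rintro (_ | i) hi b
    · rfl
    · have h1 : mixedDeltaPow p R R' A (n + 1 + 1) (i + 1) b =
          delta (p := p) (FrobeniusBase.unif_dvd (R := R')) (n + 1)
            (mixedDeltaPow p R R' A (n + 1) i b) := rfl
      rw [h1, ih i (by omega), delta_incl]
      rfl

theorem comparePoly_incl (n : ℕ) (x : JetPoly R' (R' ⊗[R] A) n) :
    comparePoly p R R' A (n + 1) (incl R' _ n x) =
      incl R' A n (comparePoly p R R' A n x) := by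
  have : (comparePoly p R R' A (n + 1)).comp (incl R' _ n) =
      (incl R' A n).comp (comparePoly p R R' A n) := by
    ext v : 1
    simp only [comparePoly, incl, AlgHom.comp_apply, MvPolynomial.rename_X, MvPolynomial.aeval_X]
    exact mixedDeltaPow_castSucc p R R' A n v.1 (by omega) v.2
  exact DFunLike.congr_fun this x

theorem comparePoly_frob (n : ℕ) (x : JetPoly R' (R' ⊗[R] A) n) :
    comparePoly p R R' A (n + 1) (frob p _ (FrobeniusBase.unif p : R') n x) =
      frob p A (p : R') n (comparePoly p R R' A n x) := by
  induction x using MvPolynomial.induction_on with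
  | C a => simp [comparePoly, frob, MvPolynomial.algebraMap_eq]
  | add f g hf hg => simp only [map_add, hf, hg]
  | mul_X f v hf =>
    rw [map_mul, map_mul, map_mul, map_mul, hf]
    congr 1
    have h1 := unif_mul_delta (p := p) (FrobeniusBase.unif_dvd (R := R')) n
      (mixedDeltaPow p R R' A n v.1 v.2)
    have h2 : mixedDeltaPow p R R' A (n + 1) (v.1 + 1) v.2 =
      delta (p := p) (FrobeniusBase.unif_dvd (R := R')) n (mixedDeltaPow p R R' A n v.1 v.2) := rfl
    have h3 := mixedDeltaPow_castSucc p R R' A n v.1 (by omega) v.2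
    have h4 : comparePoly p R R' A n (MvPolynomial.X v) = mixedDeltaPow p R R' A n v.1 v.2 :=
      MvPolynomial.aeval_X _ _
    have h5 : frob p _ (FrobeniusBase.unif p : R') n (MvPolynomial.X v :
        JetPoly R' (R' ⊗[R] A) n) = MvPolynomial.X (v.1.castSucc, v.2) ^ p +
          MvPolynomial.C (FrobeniusBase.unif p : R') * MvPolynomial.X (v.1.succ, v.2) := by
      simp [frob]
    rw [h4, h5, map_add, map_pow, map_mul]
    have h6 : comparePoly p R R' A (n + 1) (MvPolynomial.X (v.1.castSucc, v.2)) =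
        mixedDeltaPow p R R' A (n + 1) v.1 v.2 := MvPolynomial.aeval_X _ _
    have h7 : comparePoly p R R' A (n + 1) (MvPolynomial.X (v.1.succ, v.2)) =
        mixedDeltaPow p R R' A (n + 1) (v.1 + 1) v.2 := MvPolynomial.aeval_X _ _
    have h8 : comparePoly p R R' A (n + 1) (MvPolynomial.C (FrobeniusBase.unif p : R')) =
        MvPolynomial.C (FrobeniusBase.unif p : R') := MvPolynomial.aeval_C _ _
    rw [h6, h7, h8, h3, h2, h1]
    ring

theorem comparePoly_delta (n : ℕ) (x : JetPoly R' (R' ⊗[R] A) n) :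
    comparePoly p R R' A (n + 1) (delta (dvd_refl (FrobeniusBase.unif p : R')) n x) =
      delta (p := p) (FrobeniusBase.unif_dvd (R := R')) n (comparePoly p R R' A n x) := by
  apply unif_cancel (p := p)
  rw [unif_mul_delta, ← comparePoly_frob, ← comparePoly_incl, ← map_pow, ← map_sub,
    ← unif_mul_delta (dvd_refl (FrobeniusBase.unif p : R')), map_mul]
  congr 1
  exact (MvPolynomial.aeval_C _ _).symm

theorem comparePoly_mem [FrobeniusExt p R R'] (n : ℕ) :
    ∀ x ∈ jetIdeal p R' (R' ⊗[R] A) n,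
      comparePoly p R R' A n x ∈ RingHom.ker (mixedProj p R R' A n) := by
  induction n with
  | zero =>
    intro x hx
    have key : (mixedProj p R R' A 0).comp (comparePoly p R R' A 0) =
        (Algebra.TensorProduct.map (AlgHom.id R' R')
          ((JetAlg.zeroEquiv p R A).symm : A →ₐ[R] JetAlg p R A 0)).comp
        (MvPolynomial.aeval (fun v => v.2)) := by
      ext v : 1
      simp only [comparePoly, AlgHom.comp_apply, MvPolynomial.aeval_X]
      exact Function.surjInv_eq (mixedProj_surjective p R R' A 0) _
    have hx' : (MvPolynomial.aeval (fun v => v.2) :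
      JetPoly R' (R' ⊗[R] A) 0 →ₐ[R'] R' ⊗[R] A) x = 0 := hx
    have := DFunLike.congr_fun key x
    rw [AlgHom.comp_apply, AlgHom.comp_apply, hx', map_zero] at this
    exact this
  | succ n ih =>
    intro x hx
    have : jetIdeal p R' (R' ⊗[R] A) (n + 1) ≤
        (RingHom.ker (mixedProj p R R' A (n + 1))).comap (comparePoly p R R' A (n + 1)) := by
      refine Ideal.span_le.2 ?_
      rintro _ (⟨y, hy, rfl⟩ | ⟨y, hy, rfl⟩)
      · rw [SetLike.mem_coe, Ideal.mem_comap]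
        rw [comparePoly_incl]
        exact ker_mixedProj_incl R' n (ih y hy)
      · rw [SetLike.mem_coe, Ideal.mem_comap]
        rw [comparePoly_delta]
        exact ker_mixedProj_delta R' n (ih y hy)
    exact this hx

/-- The canonical morphism `(R' ⊗ A)ⁿ → R' ⊗ Aⁿ` from the universal `δ_π`-prolongation sequence of
`R' ⊗ A` to the base change of the universal `δ_p`-prolongation sequence of `A`. -/
def compareAlg [FrobeniusExt p R R'] (n : ℕ) :
    JetAlg p R' (R' ⊗[R] A) n →ₐ[R'] R' ⊗[R] JetAlg p R A n :=
  Ideal.Quotient.liftₐ (jetIdeal p R' (R' ⊗[R] A) n)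
    ((mixedProj p R R' A n).comp (comparePoly p R R' A n)) (comparePoly_mem p R R' A n)

end Compare

/-! ### Completed tensor products -/

section Complete

theorem isAdicComplete_span_iff {p : ℕ} (S : Type*) [CommRing S] (M : Type*) [AddCommGroup M]
    [Module S M] : IsAdicComplete (Ideal.span {(p : S)}) M ↔
      (∀ x : M, (∀ n, ∃ y : M, x = p ^ n • y) → x = 0) ∧
      (∀ f : ℕ → M, (∀ m n, m ≤ n → ∃ y : M, f m - f n = p ^ m • y) →
        ∃ L, ∀ n, ∃ y : M, f n - L = p ^ n • y) := by
  have key : ∀ (n : ℕ) (x y : M),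
      x ≡ y [SMOD (Ideal.span {(p : S)} ^ n • ⊤ : Submodule S M)] ↔
        ∃ z : M, x - y = p ^ n • z := by
    intro n x y
    rw [SModEq.sub_mem, Ideal.span_singleton_pow, Submodule.ideal_span_singleton_smul,
      Submodule.mem_smul_pointwise_iff_exists]
    constructor
    · rintro ⟨z, -, hz⟩
      exact ⟨z, by rw [← hz, ← Nat.cast_pow, Nat.cast_smul_eq_nsmul]⟩
    · rintro ⟨z, hz⟩
      exact ⟨z, trivial, by rw [hz, ← Nat.cast_pow, Nat.cast_smul_eq_nsmul]⟩
  constructor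
  · intro h
    refine ⟨fun x hx => h.haus x fun n => (key n x 0).2 ?_, fun f hf => ?_⟩
    · simpa using hx n
    · obtain ⟨L, hL⟩ := h.prec (f := f) (fun {m n} hmn => (key m _ _).2 (hf m n hmn))
      exact ⟨L, fun n => (key n _ _).1 (hL n)⟩
  · rintro ⟨h1, h2⟩
    exact
      { haus' := fun x hx => h1 x fun n => by simpa using (key n x 0).1 (hx n)
        prec' := fun f hf => by
          obtain ⟨L, hL⟩ := h2 f fun m n hmn => (key m _ _).1 (hf hmn)
          exact ⟨L, fun n => (key n _ _).2 (hL n)⟩ }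

theorem isAdicComplete_tensor (p : ℕ) (R R' M : Type*) [CommRing R] [CommRing R'] [Algebra R R']
    [Module.Free R R'] [Module.Finite R R'] [CommRing M] [Algebra R M]
    (hM : IsAdicComplete (Ideal.span {(p : M)}) M) :
    IsAdicComplete (Ideal.span {(p : R' ⊗[R] M)}) (R' ⊗[R] M) := by
  classical
  rw [isAdicComplete_span_iff] at hM ⊢
  obtain ⟨h1, h2⟩ := hM
  let b := Module.Free.chooseBasis R R'
  obtain ⟨e⟩ : Nonempty (R' ⊗[R] M ≃+ (Module.Free.ChooseBasisIndex R R' → M)) :=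
    ⟨((TensorProduct.comm R R' M).trans ((LinearEquiv.lTensor M b.equivFun).trans
      (TensorProduct.piScalarRight R R M _))).toAddEquiv⟩
  constructor
  · intro x hx
    apply e.injective
    rw [map_zero]
    funext i
    apply h1
    intro n
    obtain ⟨y, rfl⟩ := hx n
    exact ⟨e y i, by rw [map_nsmul]; rfl⟩
  · intro f hf
    have : ∀ i, ∃ L : M, ∀ n, ∃ y : M, e (f n) i - L = p ^ n • y := by
      intro i
      refine h2 (fun n => e (f n) i) ?_
      intro m n hmn
      obtain ⟨y, hy⟩ := hf m n hmn
      refine ⟨e y i, ?_⟩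
      rw [← Pi.sub_apply, ← map_sub, hy, map_nsmul]; rfl
    choose L hL using this
    choose y hy using hL
    refine ⟨e.symm L, fun n => ⟨e.symm fun i => y i n, ?_⟩⟩
    apply e.injective
    rw [map_sub, map_nsmul, e.apply_symm_apply, e.apply_symm_apply]
    funext i
    exact hy i n

variable (p : ℕ) [Fact p.Prime] (R R' : Type*) [CommRing R] [CommRing R'] [Algebra R R']
  [FrobeniusBase p R] [FrobeniusBase p R'] (A : Type*) [CommRing A] [Algebra R A]

theorem isAdicComplete_jetRing (n : ℕ) :
    IsAdicComplete (Ideal.span {(p : JetRing p R A n)}) (JetRing p R A n) := by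
  rw [isAdicComplete_span_iff]
  have h : IsAdicComplete (Ideal.span {(p : JetAlg p R A n)})
      (AdicCompletion (Ideal.span {(p : JetAlg p R A n)}) (JetAlg p R A n)) :=
    AdicCompletion.isAdicComplete ⟨{(p : JetAlg p R A n)}, by simp⟩
  rw [isAdicComplete_span_iff] at h
  exact h

instance [FrobeniusExt p R R'] (n : ℕ) : IsAdicComplete
    (Ideal.span {(p : R' ⊗[R] JetRing p R A n)}) (R' ⊗[R] JetRing p R A n) :=
  haveI := FrobeniusExt.free (p := p) (R := R) (R' := R')
  haveI := FrobeniusExt.finite (p := p) (R := R) (R' := R')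
  isAdicComplete_tensor p R R' _ (isAdicComplete_jetRing p R A n)

/-- The canonical homomorphism `O(Jⁿ_π(Spec (R' ⊗ A))) → R' ⊗ O(Jⁿ_p(Spec A))`. -/
def compare [FrobeniusExt p R R'] (n : ℕ) :
    JetRing p R' (R' ⊗[R] A) n →+* R' ⊗[R] JetRing p R A n :=
  completionLift p ((Algebra.TensorProduct.map (AlgHom.id R' R') (JetRing.of p R A n)).comp
    (compareAlg p R R' A n) : JetAlg p R' (R' ⊗[R] A) n →+* R' ⊗[R] JetRing p R A n)

end Complete

/-! ### Jet spaces of a smooth scheme -/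

section Global

variable {p : ℕ} [Fact p.Prime] {X : Scheme.{0}} (f : X ⟶ Spec (CommRingCat.of (Rp p)))

/-- The ring `O(U)` of an affine open subset `U` of an `R_p`-scheme, as an `R_p`-algebra. -/
def Sec (_f : X ⟶ Spec (CommRingCat.of (Rp p))) (U : X.affineOpens) : Type := Γ(X, U.1)

instance (U : X.affineOpens) : CommRing (Sec f U) := inferInstanceAs (CommRing Γ(X, U.1))

instance (U : X.affineOpens) : Algebra (Rp p) (Sec f U) :=
  ((f.appLE ⊤ U.1 le_top).hom.comp
    (Scheme.ΓSpecIso (CommRingCat.of (Rp p))).inv.hom : Rp p →+* Γ(X, U.1)).toAlgebra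

/-- The restriction `O(V) → O(U)` for affine open sets `U ⊆ V`. -/
def Sec.res {U V : X.affineOpens} (h : U ≤ V) : Sec f V →ₐ[Rp p] Sec f U where
  toRingHom := (X.presheaf.map (CategoryTheory.homOfLE h).op).hom
  commutes' r := by
    have := Scheme.Hom.appLE_map f (U := ⊤) (V := V.1) (V' := U.1) le_top
      (CategoryTheory.homOfLE h).op
    exact congrArg (fun q => q.hom ((Scheme.ΓSpecIso (CommRingCat.of (Rp p))).inv.hom r)) this

/-- The ring `O(Jⁿ_p(U))`, for `U` affine open in `X`. -/
abbrev PJet (n : ℕ) (U : X.affineOpens) : Type := JetRing p (Rp p) (Sec f U) n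

/-- The ring `O(Jⁿ_π(U_{R_π}))`, for `U` affine open in `X`. -/
abbrev PiJet (E : EisensteinPoly p) (n : ℕ) (U : X.affineOpens) : Type :=
  JetRing p (Rpi E) (Rpi E ⊗[Rp p] Sec f U) n

/-- The restriction `O(Jⁿ_p(V)) → O(Jⁿ_p(U))`. -/
def PJet.res (n : ℕ) {U V : X.affineOpens} (h : U ≤ V) : PJet f n V →+* PJet f n U :=
  JetRing.map p (Sec.res f h) n

/-- The restriction `O(Jⁿ_π(V_{R_π})) → O(Jⁿ_π(U_{R_π}))`. -/
def PiJet.res (E : EisensteinPoly p) (n : ℕ) {U V : X.affineOpens} (h : U ≤ V) :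
    PiJet f E n V →+* PiJet f E n U :=
  JetRing.map p
    (Algebra.TensorProduct.map (AlgHom.id (Rpi E) (Rpi E)) (Sec.res f h) :
      Rpi E ⊗[Rp p] Sec f V →ₐ[Rpi E] Rpi E ⊗[Rp p] Sec f U) n

/-- The ring `O(Jⁿ_p(X))` of global functions on the `p`-jet space of `X`. The jet space is glued
from the jet spaces of the affine open subsets of `X`. -/
def PFun (n : ℕ) : Subring (∀ U : X.affineOpens, PJet f n U) where
  carrier := {s | ∀ (U V : X.affineOpens) (h : U ≤ V), PJet.res f n h (s V) = s U}
  mul_mem' hs ht U V h := by simp only [Pi.mul_apply, map_mul, hs U V h, ht U V h]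
  one_mem' U V h := by simp only [Pi.one_apply, map_one]
  add_mem' hs ht U V h := by simp only [Pi.add_apply, map_add, hs U V h, ht U V h]
  zero_mem' U V h := by simp only [Pi.zero_apply, map_zero]
  neg_mem' hs U V h := by simp only [Pi.neg_apply, map_neg, hs U V h]

/-- The ring `O(Jⁿ_π(X_{R_π}))` of global functions on the `π`-jet space of `X_{R_π}`. The jet
space is glued from the jet spaces of the open sets `U_{R_π}`, for `U` affine open in `X`. -/
def PiFun (E : EisensteinPoly p) (n : ℕ) : Subring (∀ U : X.affineOpens, PiJet f E n U) where
  carrier := {s | ∀ (U V : X.affineOpens) (h : U ≤ V), PiJet.res f E n h (s V) = s U}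
  mul_mem' hs ht U V h := by simp only [Pi.mul_apply, map_mul, hs U V h, ht U V h]
  one_mem' U V h := by simp only [Pi.one_apply, map_one]
  add_mem' hs ht U V h := by simp only [Pi.add_apply, map_add, hs U V h, ht U V h]
  zero_mem' U V h := by simp only [Pi.zero_apply, map_zero]
  neg_mem' hs U V h := by simp only [Pi.neg_apply, map_neg, hs U V h]

/-- The canonical homomorphism `O(Jⁿ_π(U_{R_π})) → R_π ⊗ O(Jⁿ_p(U))`. -/
def toPJet (E : EisensteinPoly p) (n : ℕ) (U : X.affineOpens) :
    PiJet f E n U →+* Rpi E ⊗[Rp p] PJet f n U :=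
  compare p (Rp p) (Rpi E) (Sec f U) n

/-- The map `Tr ⊗ 1 : R_π ⊗ O(Jⁿ_p(U)) → O(Jⁿ_p(U))`. -/
def traceMap (E : EisensteinPoly p) (n : ℕ) (U : X.affineOpens) :
    Rpi E ⊗[Rp p] PJet f n U →ₗ[Rp p] PJet f n U :=
  (TensorProduct.lid (Rp p) (PJet f n U)).toLinearMap ∘ₗ
    (Algebra.trace (Rp p) (Rpi E)).rTensor (PJet f n U)

/-- `δ_π`-overconvergence: some `p ^ ν` times `s` is in the image of
`O(Jⁿ_π(X_{R_π})) → R_π ⊗ O(Jⁿ_p(X))`. -/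
def IsOverconvergent (E : EisensteinPoly p) (n : ℕ) (s : PFun f n) : Prop :=
  ∃ ν : ℕ, ∃ g : PiFun f E n, ∀ U, toPJet f E n U (g.1 U) = 1 ⊗ₜ ((p : PJet f n U) ^ ν * s.1 U)

/-- The form of `δ_π`-overconvergence that uses the trace: some `p ^ ν` times `s` is in the image
of the arithmetic trace `O(Jⁿ_π(X_{R_π})) → R_π ⊗ O(Jⁿ_p(X)) → O(Jⁿ_p(X))`. -/
def IsTraceOverconvergent (E : EisensteinPoly p) (n : ℕ) (s : PFun f n) : Prop :=
  ∃ ν : ℕ, ∃ g : PiFun f E n, ∀ U,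
    traceMap f E n U (toPJet f E n U (g.1 U)) = (p : PJet f n U) ^ ν * s.1 U

/-- An `R_p`-derivation of the structure sheaf of `X`. -/
structure SheafDer where
  der : ∀ U : X.affineOpens, Derivation (Rp p) (Sec f U) (Sec f U)
  res_der : ∀ (U V : X.affineOpens) (h : U ≤ V) (a : Sec f V),
    Sec.res f h (der V a) = der U (Sec.res f h a)

/-- An `R_p`-derivation of the sheaf of functions `U ↦ O(Jʳ_p(U))`. -/
structure JetDer (r : ℕ) where
  der : ∀ U : X.affineOpens, Derivation (Rp p) (PJet f r U) (PJet f r U)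
  res_der : ∀ (U V : X.affineOpens) (h : U ≤ V) (a : PJet f r V),
    PJet.res f r h (der V a) = der U (PJet.res f r h a)

variable {f}

/-- The action of a derivation on `O(Jʳ_p(X))`. -/
def JetDer.app {r : ℕ} (D : JetDer f r) (s : PFun f r) : PFun f r :=
  ⟨fun U => D.der U (s.1 U), fun U V h => by rw [D.res_der, s.2 U V h]⟩

/-- The extension of a derivation to an `R_π`-linear map of `R_π ⊗ O(Jʳ_p(U))`. -/
def JetDer.ext {r : ℕ} (D : JetDer f r) (E : EisensteinPoly p) (U : X.affineOpens) :
    Rpi E ⊗[Rp p] PJet f r U →ₗ[Rpi E] Rpi E ⊗[Rp p] PJet f r U :=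
  (D.der U : PJet f r U →ₗ[Rp p] PJet f r U).baseChange (Rpi E)

/-- The defining properties of the conjugate operators `∂_0, …, ∂_r` of `∂`: on functions of `X`,
`∂_j ∘ φˢ = 0` for `s ≠ j` and `∂_j ∘ φʲ = p ^ j • φʲ ∘ ∂`. -/
def IsConjugate (d : SheafDer f) {r : ℕ} (D : Fin (r + 1) → JetDer f r) : Prop :=
  ∀ (U : X.affineOpens) (j : Fin (r + 1)) (a : Sec f U),
    (∀ s : Fin (r + 1), s ≠ j → (D j).der U (JetRing.phiPow p (Rp p) r s a) = 0) ∧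
    (D j).der U (JetRing.phiPow p (Rp p) r j a) =
      (p : PJet f r U) ^ (j : ℕ) * JetRing.phiPow p (Rp p) r j (d.der U a)

end Global

end ArithJet

end

noncomputable section

namespace ArithJet

namespace JetPoly

open MvPolynomial

/-! ### Conjugate derivations of polynomial jet rings -/

section Basic

variable {p : ℕ} {S : Type*} [CommRing S] [FrobeniusBase p S] {ι : Type*}

/-! Everything rests on one recursion. Let φ(z) = z^p + t·δz and te = p, and read ∂_{-1} as 0. If
∂_j(δz) = φ(∂_{j-1} z) − e·z^(p-1)·∂_j z, then the two terms p·z^(p-1)·∂_j z in ∂_j(φz) cancel, and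
∂_j∘φ = t·φ∘∂_{j-1} (`conjDer_frob`). On a polynomial jet ring this recursion is a definition,
because a derivation may be prescribed freely on the variables (`conjDer`). It involves no
denominators. Since δ and φ preserve the relations, so do the ∂_j, and they pass to jet algebras and
to their p-adic completions.

For t = p, e = 1 these are the conjugate operators of the p-jets. For t = π, e = c := p/π they are
derivations ∂_j^π of the π-jets with ∂_j^π∘φ^j = π^j·φ^j∘∂. The comparison map commutes with φ, and
φ(c) = c, so the identity p^j = c^j·π^j says that it carries c^j·∂_j^π to ∂_j. This is proved on
polynomials modulo relations (`comparePoly_conjDer`), then on jet algebras and completions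
(`compare_conjDer`), and it is compatible with restriction. Hence the image of ι_r is stable under
every ∂_j, for every r (`SheafDer.exists_conj_toPJet`); the last claim is the case r = 1. Both forms
of overconvergence follow, because ∂_j commutes with p^ν and with the R_p-linear trace.

Smoothness is needed for the uniqueness of the ∂_j. A section of P/J² → A prolongs to all orders, so
the terms of the universal prolongation sequence are formally smooth. Being quotients of Noetherian
polynomial rings they are flat, and their completions have no p-torsion (`jetRing_torsionFree`). As
p·δz = φ(z) − z^p, a derivation of such a ring that kills all φ^s(b) is zero
(`derivation_eq_zero_of_phiPow`). -/

theorem incl_C (n : ℕ) (a : S) : incl S ι n (C a) = C a := by simp [incl]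

theorem incl_X (n : ℕ) (v : Fin (n + 1) × ι) :
    incl S ι n (X v) = X (v.1.castSucc, v.2) := by simp [incl]

theorem frob_C (t : S) (n : ℕ) (a : S) : frob p ι t n (C a) = C (FrobeniusBase.phi p a) := by
  simp [frob]

theorem frob_X (t : S) (n : ℕ) (v : Fin (n + 1) × ι) :
    frob p ι t n (X v) = X (v.1.castSucc, v.2) ^ p + C t * X (v.1.succ, v.2) := by
  simp [frob]

theorem frob_incl (t : S) (n : ℕ) (x : JetPoly S ι n) :
    frob p ι t (n + 1) (incl S ι n x) = incl S ι (n + 1) (frob p ι t n x) := by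
  induction x using MvPolynomial.induction_on with
  | C a => simp only [incl_C, frob_C]
  | add f g hf hg => simp only [map_add, hf, hg]
  | mul_X f v hf =>
    rw [map_mul, map_mul, map_mul, map_mul, hf]
    congr 1
    simp [frob, incl]

end Basic

section ConjDer

variable (p : ℕ) {S : Type*} [CommRing S] [FrobeniusBase p S] {ι : Type*} (t e : S) (d : ι → ι)

/-- The conjugate derivations `∂_j`, for `j ∈ ℕ`, of `S[x, δ x, …, δⁿ x]` attached to the
derivation `x_a ↦ x_{d a}` of `S[x]`. They are characterized by `∂_0 x_a = x_{d a}`, `∂_j x_a = 0`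
for `j > 0`, and `∂_j (δ z) = φ (∂_{j-1} z) - e z ^ (p - 1) ∂_j z` for `z = δⁱ x_a`. -/
def conjDer : ∀ n : ℕ, ℕ → Derivation S (JetPoly S ι n) (JetPoly S ι n)
  | 0, 0 => mkDerivation S fun v => X (0, d v.2)
  | 0, _ + 1 => 0
  | n + 1, 0 => mkDerivation S fun v =>
      Fin.lastCases (motive := fun _ => JetPoly S ι (n + 1))
        (-(C e * X ((Fin.last n).castSucc, v.2) ^ (p - 1) *
          incl S ι n (conjDer n 0 (X (Fin.last n, v.2)))))
        (fun k => incl S ι n (conjDer n 0 (X (k, v.2)))) v.1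
  | n + 1, j + 1 => mkDerivation S fun v =>
      Fin.lastCases (motive := fun _ => JetPoly S ι (n + 1))
        (frob p ι t n (conjDer n j (X (Fin.last n, v.2))) -
          C e * X ((Fin.last n).castSucc, v.2) ^ (p - 1) *
            incl S ι n (conjDer n (j + 1) (X (Fin.last n, v.2))))
        (fun k => incl S ι n (conjDer n (j + 1) (X (k, v.2)))) v.1

/-- The composition `φ ∘ ∂_{j-1}`, which is zero for `j = 0`. -/
def frobConjDer (n : ℕ) : ℕ → JetPoly S ι n → JetPoly S ι (n + 1)
  | 0, _ => 0
  | j + 1, z => frob p ι t n (conjDer p t e d n j z)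

theorem conjDer_zero_zero_X (v : Fin 1 × ι) : conjDer p t e d 0 0 (X v) = X (0, d v.2) := by
  simp [conjDer, mkDerivation_X]

theorem conjDer_castSucc (n j : ℕ) (k : Fin (n + 1)) (a : ι) :
    conjDer p t e d (n + 1) j (X (k.castSucc, a)) =
      incl S ι n (conjDer p t e d n j (X (k, a))) := by
  cases j <;> simp [conjDer, mkDerivation_X]

theorem conjDer_last (n j : ℕ) (a : ι) :
    conjDer p t e d (n + 1) j (X (Fin.last (n + 1), a)) =
      frobConjDer p t e d n j (X (Fin.last n, a)) -
        C e * X ((Fin.last n).castSucc, a) ^ (p - 1) *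
          incl S ι n (conjDer p t e d n j (X (Fin.last n, a))) := by
  cases j <;> simp [conjDer, frobConjDer, mkDerivation_X]

theorem conjDer_C (n j : ℕ) (a : S) : conjDer p t e d n j (C a) = 0 :=
  (conjDer p t e d n j).map_algebraMap a

theorem frobConjDer_C (n j : ℕ) (a : S) : frobConjDer p t e d n j (C a) = 0 := by
  cases j with
  | zero => rfl
  | succ j => simp only [frobConjDer, conjDer_C, map_zero]

theorem frobConjDer_add (n j : ℕ) (x y : JetPoly S ι n) : frobConjDer p t e d n j (x + y) =
    frobConjDer p t e d n j x + frobConjDer p t e d n j y := by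
  cases j <;> simp [frobConjDer]

theorem frobConjDer_mul (n j : ℕ) (x y : JetPoly S ι n) : frobConjDer p t e d n j (x * y) =
    frob p ι t n x * frobConjDer p t e d n j y + frob p ι t n y * frobConjDer p t e d n j x := by
  cases j <;> simp [frobConjDer]

theorem conjDer_incl (n j : ℕ) (x : JetPoly S ι n) :
    conjDer p t e d (n + 1) j (incl S ι n x) = incl S ι n (conjDer p t e d n j x) := by
  induction x using MvPolynomial.induction_on with
  | C a => rw [incl_C, conjDer_C, conjDer_C, map_zero]
  | add f g hf hg => simp only [map_add, hf, hg]
  | mul_X f v hf =>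
    rw [map_mul, Derivation.leibniz, Derivation.leibniz, hf, incl_X, conjDer_castSucc]
    simp only [smul_eq_mul, map_add, map_mul, incl_X]

theorem frobConjDer_incl (n j : ℕ) (x : JetPoly S ι n) :
    frobConjDer p t e d (n + 1) j (incl S ι n x) =
      incl S ι (n + 1) (frobConjDer p t e d n j x) := by
  cases j with
  | zero => simp [frobConjDer]
  | succ j => simp only [frobConjDer, conjDer_incl, frob_incl]

variable {t e}

/-- The correction term of the recursion is multiplied by t·e = p and cancels the derivative of z^p.
-/
theorem conjDer_frob_X_last (hte : t * e = p) (n j : ℕ) (a : ι) :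
    conjDer p t e d (n + 1) j (frob p ι t n (X (Fin.last n, a))) =
      C t * frobConjDer p t e d n j (X (Fin.last n, a)) := by
  have hC : C t * C e = ((p : ℕ) : JetPoly S ι (n + 1)) := by rw [← C_mul, hte, map_natCast]
  rw [frob_X, map_add, Derivation.leibniz_pow, Derivation.leibniz, conjDer_C, Fin.succ_last,
    conjDer_last, conjDer_castSucc]
  simp only [smul_eq_mul, nsmul_eq_mul, mul_zero, add_zero]
  rw [← hC]
  ring

theorem conjDer_frob_X (hte : t * e = p) (n j : ℕ) (v : Fin (n + 1) × ι) :
    conjDer p t e d (n + 1) j (frob p ι t n (X v)) = C t * frobConjDer p t e d n j (X v) := by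
  obtain ⟨k, a⟩ := v
  induction n with
  | zero =>
    obtain rfl : k = Fin.last 0 := Fin.ext (by omega)
    exact conjDer_frob_X_last p d hte 0 j a
  | succ n ih =>
    -- A variable below the top order comes from the previous ring, and both sides commute with the
    -- inclusion.
    induction k using Fin.lastCases with
    | last => exact conjDer_frob_X_last p d hte _ j a
    | cast k =>
      rw [← incl_X n (k, a), frob_incl, conjDer_incl, ih k, frobConjDer_incl, map_mul, incl_C]

/-- Both sides are additive, vanish on constants and obey the Leibniz rule along φ, so the variables
decide. -/
theorem conjDer_frob (hte : t * e = p) (n j : ℕ) (x : JetPoly S ι n) :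
    conjDer p t e d (n + 1) j (frob p ι t n x) = C t * frobConjDer p t e d n j x := by
  induction x using MvPolynomial.induction_on with
  | C a => rw [frob_C, conjDer_C, frobConjDer_C, mul_zero]
  | add f g hf hg => rw [map_add, map_add, hf, hg, frobConjDer_add, mul_add]
  | mul_X f v hf =>
    rw [map_mul, Derivation.leibniz, hf, conjDer_frob_X p d hte, frobConjDer_mul]
    simp only [smul_eq_mul]
    ring

variable {p}

/-- Differentiate ϖ·δx = φ(x) − x^p and cancel ϖ. The parameter t may be a proper multiple of ϖ:
over R_π the p-jets have t = p, while δ_π still divides by π. -/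
theorem conjDer_delta [Fact p.Prime] (hte : t * e = p) (ht : FrobeniusBase.unif p ∣ t) {u c : S}
    (hu : t = FrobeniusBase.unif p * u) (hc : (p : S) = FrobeniusBase.unif p * c) (n j : ℕ)
    (x : JetPoly S ι n) :
    conjDer p t e d (n + 1) j (delta ht n x) = C u * frobConjDer p t e d n j x -
      C c * incl S ι n x ^ (p - 1) * incl S ι n (conjDer p t e d n j x) := by
  apply unif_cancel (p := p)
  have h := congrArg (conjDer p t e d (n + 1) j) (unif_mul_delta ht n x)
  rw [Derivation.leibniz, conjDer_C, map_sub, conjDer_frob p d hte, Derivation.leibniz_pow,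
    conjDer_incl] at h
  simp only [smul_eq_mul, nsmul_eq_mul, mul_zero, add_zero] at h
  have hC : ((p : ℕ) : JetPoly S ι (n + 1)) = C (FrobeniusBase.unif p) * C c := by
    rw [← C_mul, ← hc, map_natCast]
  rw [h, hC]
  nth_rewrite 1 [hu]
  rw [C_mul]
  ring

end ConjDer

end JetPoly

open MvPolynomial JetPoly

/-! ### Conjugate derivations and relations: stability, naturality, values on φ^s -/

section JetIdeal

variable {p : ℕ} [Fact p.Prime] {R : Type*} [CommRing R] [FrobeniusBase p R]
  {B B' : Type*} [CommRing B] [Algebra R B] [CommRing B'] [Algebra R B']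

theorem jetIdeal_frob (n : ℕ) {x : JetPoly R B n} (hx : x ∈ jetIdeal p R B n) :
    frob p B (FrobeniusBase.unif p : R) n x ∈ jetIdeal p R B (n + 1) := by
  have h := unif_mul_delta (p := p) (dvd_refl (FrobeniusBase.unif p : R)) n x
  rw [show frob p B (FrobeniusBase.unif p : R) n x = incl R B n x ^ p +
    C (FrobeniusBase.unif p : R) * delta (p := p) (dvd_refl (FrobeniusBase.unif p : R)) n x by
      rw [h]; ring]
  exact Ideal.add_mem _
    (Ideal.pow_mem_of_mem _ (jetIdeal_incl n hx) _ (Fact.out : p.Prime).pos)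
    (Ideal.mul_mem_left _ _ (jetIdeal_delta n hx))

theorem derivation_mem_span {A : Type*} [CommRing A] [Algebra R A] (D : Derivation R A A)
    {s : Set A} (h : ∀ x ∈ s, D x ∈ Ideal.span s) {x : A} (hx : x ∈ Ideal.span s) :
    D x ∈ Ideal.span s := by
  induction hx using Submodule.span_induction with
  | mem x hx => exact h x hx
  | zero => rw [map_zero]; exact Ideal.zero_mem _
  | add x y _ _ hx hy => rw [map_add]; exact Ideal.add_mem _ hx hy
  | smul a x hx hDx =>
    rw [smul_eq_mul, Derivation.leibniz]
    exact Ideal.add_mem _ (Ideal.mul_mem_left _ _ hDx) (Ideal.mul_mem_right _ _ hx)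

theorem aeval_conjDer_zero (t e : R) (d : Derivation R B B) (x : JetPoly R B 0) :
    (aeval (fun v => v.2) : JetPoly R B 0 →ₐ[R] B) (conjDer p t e d 0 0 x) =
      d (aeval (fun v => v.2) x) := by
  induction x using MvPolynomial.induction_on with
  | C a => rw [conjDer_C, map_zero, aeval_C, Derivation.map_algebraMap]
  | add f g hf hg => simp only [map_add, hf, hg]
  | mul_X f v hf =>
    rw [Derivation.leibniz, conjDer_zero_zero_X, map_mul, Derivation.leibniz, aeval_X, ← hf]
    simp

/-- The conjugate derivations preserve the relations among `x, δ x, …, δⁿ x`. -/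
theorem conjDer_mem_jetIdeal {e : R} (he : FrobeniusBase.unif p * e = p) (d : Derivation R B B)
    (n : ℕ) : ∀ (j : ℕ), ∀ x ∈ jetIdeal p R B n,
      conjDer p (FrobeniusBase.unif p) e d n j x ∈ jetIdeal p R B n := by
  -- The index j stays universally quantified, because ∂_{j+1}(δy) involves φ(∂_j y).
  induction n with
  | zero =>
    rintro (_ | j) x hx
    · change aeval _ _ = _
      have hx' : (aeval (fun v => v.2) : JetPoly R B 0 →ₐ[R] B) x = 0 := hx
      rw [aeval_conjDer_zero, hx', map_zero]
    · exact Ideal.zero_mem _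
  | succ n ih =>
    intro j x hx
    refine derivation_mem_span _ ?_ hx
    rintro _ (⟨y, hy, rfl⟩ | ⟨y, hy, rfl⟩)
    · rw [conjDer_incl]
      exact jetIdeal_incl n (ih j y hy)
    · rw [conjDer_delta d he dvd_rfl (mul_one _).symm he.symm]
      refine Ideal.sub_mem _ (Ideal.mul_mem_left _ _ ?_)
        (Ideal.mul_mem_left _ _ (jetIdeal_incl n (ih j y hy)))
      cases j with
      | zero => exact Ideal.zero_mem _
      | succ j => exact jetIdeal_frob n (ih j y hy)

/-- The recursion is built from the inclusion, φ and the variables, all of which are natural in the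
algebra. This is what lets the operators on affine pieces commute with restriction. -/
theorem map_conjDer {d : B → B} {d' : B' → B'} (h : B →ₐ[R] B') (hd : ∀ b, h (d b) = d' (h b))
    (t e : R) (n : ℕ) : ∀ (j : ℕ) (x : JetPoly R B n),
      JetPoly.map h n (conjDer p t e d n j x) = conjDer p t e d' n j (JetPoly.map h n x) := by
  have mapX : ∀ (n : ℕ) (k : Fin (n + 1)) (b : B),
      JetPoly.map h n (X (k, b)) = X (k, h b) := fun n k b => by simp [JetPoly.map]
  have mapC : ∀ (n : ℕ) (a : R), JetPoly.map h n (C a) = C a := fun n a => by simp [JetPoly.map]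
  have ext : ∀ n, (∀ (j : ℕ) (v : Fin (n + 1) × B), JetPoly.map h n (conjDer p t e d n j (X v)) =
      conjDer p t e d' n j (JetPoly.map h n (X v))) → ∀ (j : ℕ) (x : JetPoly R B n),
      JetPoly.map h n (conjDer p t e d n j x) = conjDer p t e d' n j (JetPoly.map h n x) := by
    intro n hn j x
    induction x using MvPolynomial.induction_on with
    | C a => rw [conjDer_C, mapC, conjDer_C, map_zero]
    | add f g hf hg => simp only [map_add, hf, hg]
    | mul_X f v hf =>
      rw [Derivation.leibniz, map_mul, Derivation.leibniz, ← hf, ← hn]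
      simp
  induction n with
  | zero =>
    refine ext 0 ?_
    rintro (_ | j) ⟨k, b⟩
    · rw [conjDer_zero_zero_X, mapX, mapX, conjDer_zero_zero_X, hd]
    · exact map_zero _
  | succ n ih =>
    refine ext (n + 1) ?_
    rintro j ⟨k, b⟩
    induction k using Fin.lastCases with
    | last =>
      rw [mapX, conjDer_last, conjDer_last, map_sub, map_mul, map_mul, map_pow, mapC, mapX,
        JetPoly.map_incl, ih, mapX]
      congr 1
      cases j with
      | zero => exact map_zero _
      | succ j =>
        simp only [frobConjDer]
        rw [JetPoly.map_frob, ih, mapX]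
    | cast k => rw [mapX, conjDer_castSucc, conjDer_castSucc, JetPoly.map_incl, ih, mapX]

/-- Each use of ∂_j∘φ = p·φ∘∂_{j-1} strips one φ from φ^s and lowers j by one. If s = j the process
ends at ∂_0 x_b = x_{d b} with the factor p^j; otherwise it meets ∂_{-1} = 0 or some ∂_j x_b with j
> 0, which is 0. -/
theorem conjDer_phiPow {e : R} (hu : (FrobeniusBase.unif p : R) = p)
    (he : FrobeniusBase.unif p * e = p) (d : B → B) (b : B) (r : ℕ) : ∀ (j s : ℕ), s ≤ r →
      conjDer p (FrobeniusBase.unif p) e d r j (JetPoly.phiPow p R r s b) =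
        if s = j then (p : JetPoly R B r) ^ j * JetPoly.phiPow p R r j (d b) else 0 := by
  induction r with
  | zero =>
    rintro (_ | j) s hs
    · obtain rfl : s = 0 := by omega
      simp only [JetPoly.phiPow, conjDer_zero_zero_X]
      simp
    · rw [if_neg (by omega)]
      rfl
  | succ r ih =>
    rintro j (_ | s) hs
    · simp only [JetPoly.phiPow]
      rw [conjDer_incl, ih j 0 (by omega)]
      split_ifs with h
      · subst h; simp [JetPoly.phiPow]
      · exact map_zero _
    · simp only [JetPoly.phiPow]
      rw [conjDer_frob p d he]
      cases j with
      | zero => simp [frobConjDer]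
      | succ j =>
        simp only [frobConjDer, JetPoly.phiPow]
        rw [ih j s (by omega)]
        simp only [add_left_inj]
        split_ifs with h
        · rw [map_mul, map_pow, map_natCast, hu, map_natCast]
          ring
        · rw [map_zero, mul_zero]

end JetIdeal

/-! ### Scalar extension of derivations -/

section BaseChange

variable {R : Type*} (R' : Type*) [CommRing R] [CommRing R'] [Algebra R R']
  {A : Type*} [CommRing A] [Algebra R A]

/-- The `R'`-linear extension of a derivation of `A` to `R' ⊗ A`. -/
def derBaseChange (d : Derivation R A A) : Derivation R' (R' ⊗[R] A) (R' ⊗[R] A) :=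
  Derivation.mk' ((d : A →ₗ[R] A).baseChange R') (by
    intro x y
    induction x using TensorProduct.induction_on with
    | zero => simp
    | add x x' hx hx' => rw [add_mul, map_add, hx, hx', map_add, add_smul, smul_add]; abel
    | tmul r a =>
      induction y using TensorProduct.induction_on with
      | zero => simp
      | add y y' hy hy' => rw [mul_add, map_add, hy, hy', map_add, add_smul, smul_add]; abel
      | tmul s b =>
        simp [Algebra.TensorProduct.tmul_mul_tmul, TensorProduct.tmul_add, mul_comm s r])

theorem derBaseChange_apply (d : Derivation R A A) (x : R' ⊗[R] A) :
    derBaseChange R' d x = (d : A →ₗ[R] A).baseChange R' x := rfl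

theorem derBaseChange_tmul (d : Derivation R A A) (r : R') (a : A) :
    derBaseChange R' d (r ⊗ₜ a) = r ⊗ₜ d a := rfl

end BaseChange

/-! ### Conjugate derivations under the comparison map, on polynomials -/

section Compare

variable {p : ℕ} [Fact p.Prime] (R R' : Type*) [CommRing R] [CommRing R'] [Algebra R R']
  [FrobeniusBase p R] [FrobeniusBase p R'] (A : Type*) [CommRing A] [Algebra R A]

variable {R A} in
theorem ker_mixedProj_frob [FrobeniusExt p R R'] (n : ℕ) {x : JetPoly R' A n}
    (hx : x ∈ RingHom.ker (mixedProj p R R' A n)) :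
    frob p A (p : R') n x ∈ RingHom.ker (mixedProj p R R' A (n + 1)) := by
  have h := unif_mul_delta (p := p) (FrobeniusBase.unif_dvd (R := R')) n x
  rw [show frob p A (p : R') n x = incl R' A n x ^ p +
    C (FrobeniusBase.unif p : R') * delta (p := p) (FrobeniusBase.unif_dvd (R := R')) n x by
      rw [h]; ring]
  exact Ideal.add_mem _
    (Ideal.pow_mem_of_mem _ (ker_mixedProj_incl R' n hx) _ (Fact.out : p.Prime).pos)
    (Ideal.mul_mem_left _ _ (ker_mixedProj_delta R' n hx))

/-- In order zero the projection is evaluation at x_a = 1 ⊗ a, up to A⁰ ≃ A. Questions about the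
chosen lifts thereby become questions in R' ⊗ A. -/
theorem mixedProj_zero_eq (x : JetPoly R' A 0) : mixedProj p R R' A 0 x =
    Algebra.TensorProduct.map (AlgHom.id R' R')
      ((JetAlg.zeroEquiv p R A).symm : A →ₐ[R] JetAlg p R A 0)
      (aeval (fun v => (1 : R') ⊗ₜ[R] v.2) x) := by
  have h : mixedProj p R R' A 0 = (Algebra.TensorProduct.map (AlgHom.id R' R')
      ((JetAlg.zeroEquiv p R A).symm : A →ₐ[R] JetAlg p R A 0)).comp
      (aeval (fun v => (1 : R') ⊗ₜ[R] v.2)) := by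
    ext v : 1
    obtain ⟨k, a⟩ := v
    obtain rfl : k = 0 := Fin.ext (by omega)
    simp only [mixedProj, AlgHom.comp_apply, aeval_X, Algebra.TensorProduct.map_tmul,
      AlgHom.id_apply]
    congr 1
    refine ((JetAlg.zeroEquiv p R A).symm_apply_eq.2 ?_).symm
    exact (aeval_X (fun v : Fin 1 × A => v.2) (0, a)).symm
  exact DFunLike.congr_fun h x

theorem aeval_conjDer_mixed (t e : R') (d : Derivation R A A) (x : JetPoly R' A 0) :
    aeval (fun v => (1 : R') ⊗ₜ[R] v.2) (conjDer p t e d 0 0 x) =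
      derBaseChange R' d (aeval (fun v => (1 : R') ⊗ₜ[R] v.2) x) := by
  induction x using MvPolynomial.induction_on with
  | C a => rw [conjDer_C, map_zero, aeval_C, Derivation.map_algebraMap]
  | add f g hf hg => simp only [map_add, hf, hg]
  | mul_X f v hf =>
    rw [Derivation.leibniz, conjDer_zero_zero_X, map_mul, Derivation.leibniz, aeval_X, ← hf]
    simp [derBaseChange_tmul]

theorem mixedProj_mixedLift (b : R' ⊗[R] A) : mixedProj p R R' A 0 (mixedLift p R R' A b) =
    Algebra.TensorProduct.map (AlgHom.id R' R')
      ((JetAlg.zeroEquiv p R A).symm : A →ₐ[R] JetAlg p R A 0) b :=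
  Function.surjInv_eq (mixedProj_surjective p R R' A 0) _

theorem aeval_mixedLift (b : R' ⊗[R] A) :
    aeval (fun v => (1 : R') ⊗ₜ[R] v.2) (mixedLift p R R' A b) = b := by
  have h := mixedProj_mixedLift (p := p) R R' A b
  rw [mixedProj_zero_eq] at h
  exact (Algebra.TensorProduct.congr AlgEquiv.refl
    (JetAlg.zeroEquiv p R A).symm : R' ⊗[R] A ≃ₐ[R'] R' ⊗[R] JetAlg p R A 0).injective h

variable {R A} in
/-- The comparison map intertwines `(p / ϖ) ^ j` times the `j`-th conjugate derivation of the
`ϖ`-jets with the `j`-th conjugate derivation of the `p`-jets. -/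
theorem comparePoly_conjDer [FrobeniusExt p R R'] {c : R'}
    (hc : FrobeniusBase.unif p * c = p) (hφ : FrobeniusBase.phi p c = c) (d : Derivation R A A)
    (n : ℕ) : ∀ (j : ℕ) (x : JetPoly R' (R' ⊗[R] A) n),
      C c ^ j * comparePoly p R R' A n
          (conjDer p (FrobeniusBase.unif p) c (derBaseChange R' d) n j x) -
        conjDer p (p : R') 1 d n j (comparePoly p R R' A n x) ∈
          RingHom.ker (mixedProj p R R' A n) := by
  have cX : ∀ (n : ℕ) (v : Fin (n + 1) × (R' ⊗[R] A)), comparePoly p R R' A n (X v) =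
      mixedDeltaPow p R R' A n v.1 v.2 := fun n v => aeval_X _ _
  have cC : ∀ (n : ℕ) (a : R'), comparePoly p R R' A n (C a) = C a := fun n a => aeval_C _ _
  -- Both terms are derivations along the comparison map, so the difference at a product is a
  -- combination of the differences at its factors. Variables suffice.
  have ext : ∀ n, (∀ (j : ℕ) (v : Fin (n + 1) × (R' ⊗[R] A)),
      C c ^ j * comparePoly p R R' A n
          (conjDer p (FrobeniusBase.unif p) c (derBaseChange R' d) n j (X v)) -
        conjDer p (p : R') 1 d n j (comparePoly p R R' A n (X v)) ∈
          RingHom.ker (mixedProj p R R' A n)) → ∀ (j : ℕ) (x : JetPoly R' (R' ⊗[R] A) n),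
      C c ^ j * comparePoly p R R' A n
          (conjDer p (FrobeniusBase.unif p) c (derBaseChange R' d) n j x) -
        conjDer p (p : R') 1 d n j (comparePoly p R R' A n x) ∈
          RingHom.ker (mixedProj p R R' A n) := by
    intro n hn j x
    induction x using MvPolynomial.induction_on with
    | C a => rw [cC, conjDer_C, conjDer_C, map_zero, mul_zero, sub_zero]; exact Ideal.zero_mem _
    | add f g hf hg =>
      have := Ideal.add_mem _ hf hg
      simp only [map_add]
      convert this using 1
      ring
    | mul_X f v hf =>
      have := Ideal.add_mem _ (Ideal.mul_mem_left _ (comparePoly p R R' A n f) (hn j v))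
        (Ideal.mul_mem_left _ (comparePoly p R R' A n (X v)) hf)
      rw [map_mul (comparePoly p R R' A n), Derivation.leibniz, Derivation.leibniz]
      simp only [smul_eq_mul, map_add, map_mul]
      convert this using 1
      ring
  induction n with
  | zero =>
    refine ext 0 ?_
    rintro (_ | j) ⟨k, b⟩
    · rw [conjDer_zero_zero_X, pow_zero, one_mul, cX, cX, RingHom.mem_ker, map_sub, sub_eq_zero]
      -- The lifts to R'[x] are arbitrary choices, so the lift of ∂b and the derivative of the lift
      -- of b agree only after projection. This is why the statement is modulo the kernel.
      change mixedProj p R R' A 0 (mixedLift p R R' A _) =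
        mixedProj p R R' A 0 (conjDer p (p : R') 1 d 0 0 (mixedLift p R R' A b))
      rw [mixedProj_mixedLift, mixedProj_zero_eq, aeval_conjDer_mixed, aeval_mixedLift]
    · simp [conjDer]
  | succ n ih =>
    refine ext (n + 1) ?_
    rintro j ⟨k, b⟩
    induction k using Fin.lastCases with
    | last =>
      have hw : comparePoly p R R' A (n + 1) (X (Fin.last (n + 1), b)) =
          delta (p := p) (FrobeniusBase.unif_dvd (R := R')) n
            (comparePoly p R R' A n (X (Fin.last n, b))) := by
        rw [cX, cX]; rfl
      have hw' : comparePoly p R R' A (n + 1) (X ((Fin.last n).castSucc, b)) =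
          incl R' A n (comparePoly p R R' A n (X (Fin.last n, b))) := by
        rw [← comparePoly_incl, incl_X]
      -- On the target t = p = ϖ·c, so c serves both as t/ϖ and as p/ϖ.
      rw [hw, conjDer_delta d (mul_one _) _ hc.symm hc.symm, conjDer_last, map_sub, map_mul,
        map_mul, map_pow, cC, hw', comparePoly_incl]
      set w := comparePoly p R R' A n (X (Fin.last n, b))
      have h1 := Ideal.mul_mem_left _ (C c * incl R' A n w ^ (p - 1))
        (ker_mixedProj_incl R' n (ih j (X (Fin.last n, b))))
      cases j with
      | zero =>
        simp only [frobConjDer, map_zero]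
        rw [map_sub, map_mul, map_pow, incl_C] at h1
        convert neg_mem h1 using 1
        ring
      | succ j =>
        -- Applying φ to the hypothesis for j leaves c^j unchanged, as φ(c) = c; the extra factor c
        -- makes it c^(j+1).
        have h2 := Ideal.mul_mem_left _ (C c)
          (ker_mixedProj_frob R' n (ih j (X (Fin.last n, b))))
        simp only [frobConjDer]
        rw [comparePoly_frob]
        rw [map_sub, map_mul, map_pow, incl_C] at h1
        rw [map_sub, map_mul, map_pow, frob_C, hφ] at h2
        convert Ideal.sub_mem _ h2 h1 using 1
        ring
    | cast k =>
      have := ker_mixedProj_incl R' n (ih j (X (k, b)))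
      rw [map_sub, map_mul, map_pow, incl_C, ← comparePoly_incl, ← conjDer_incl, ← conjDer_incl,
        ← comparePoly_incl, incl_X] at this
      exact this

end Compare

/-! ### Derivations of `p`-adic completions -/

section Completion

variable {p : ℕ} {S : Type*} [CommRing S]

/-- Density of S in its completion. As (p) is finitely generated, the kernel of reduction modulo p^m
is p^m times the completion. -/
theorem exists_eq_algebraMap_add_nsmul (x : AdicCompletion (Ideal.span {(p : S)}) S) (m : ℕ) :
    ∃ (s : S) (y : AdicCompletion (Ideal.span {(p : S)}) S),
      x = algebraMap S (AdicCompletion (Ideal.span {(p : S)}) S) s + p ^ m • y := by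
  obtain ⟨s, hs⟩ := Submodule.mkQ_surjective _ (AdicCompletion.eval _ S m x)
  have hker : x - AdicCompletion.of (Ideal.span {(p : S)}) S s ∈
      (AdicCompletion.eval (Ideal.span {(p : S)}) S m).ker := by
    rw [LinearMap.mem_ker, map_sub, AdicCompletion.eval_of, hs, sub_self]
  rw [← AdicCompletion.pow_smul_top_eq_ker_eval ⟨{(p : S)}, by simp⟩,
    Ideal.span_singleton_pow, Submodule.ideal_span_singleton_smul,
    Submodule.mem_smul_pointwise_iff_exists] at hker
  obtain ⟨y, -, hy⟩ := hker
  refine ⟨s, y, ?_⟩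
  rw [← Nat.cast_pow, Nat.cast_smul_eq_nsmul] at hy
  rw [hy]
  exact (add_sub_cancel _ _).symm

/-- Additive maps from a `p`-adic completion `Ŝ` to a `p`-adically separated group are determined
by their restriction to `S`. -/
theorem completion_addHom_ext {M : Type*} [AddCommGroup M]
    (hM : ∀ x : M, (∀ n, ∃ y : M, x = p ^ n • y) → x = 0)
    (F G : AdicCompletion (Ideal.span {(p : S)}) S →+ M)
    (h : ∀ s, F (algebraMap S (AdicCompletion (Ideal.span {(p : S)}) S) s) =
      G (algebraMap S (AdicCompletion (Ideal.span {(p : S)}) S) s)) : F = G := by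
  ext x
  rw [← sub_eq_zero]
  refine hM _ fun n => ?_
  obtain ⟨s, y, rfl⟩ := exists_eq_algebraMap_add_nsmul x n
  exact ⟨F y - G y, by rw [map_add, map_add, h, map_nsmul, map_nsmul, nsmul_sub]; abel⟩

theorem completion_separated (x : AdicCompletion (Ideal.span {(p : S)}) S)
    (hx : ∀ n, ∃ y : AdicCompletion (Ideal.span {(p : S)}) S, x = p ^ n • y) : x = 0 := by
  have h : IsAdicComplete (Ideal.span {(p : S)}) (AdicCompletion (Ideal.span {(p : S)}) S) :=
    AdicCompletion.isAdicComplete ⟨{(p : S)}, by simp⟩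
  rw [isAdicComplete_span_iff] at h
  exact h.1 x hx

/-- Write x = s + p^n·y. Then px = 0 puts p·s in p^(n+1)·S, so s lies in p^n·S because S has no
p-torsion. Thus x is divisible by every p^n, and the completion is separated. -/
theorem completion_torsionFree (h : ∀ x : S, (p : S) * x = 0 → x = 0)
    (x : AdicCompletion (Ideal.span {(p : S)}) S)
    (hx : (p : AdicCompletion (Ideal.span {(p : S)}) S) * x = 0) : x = 0 := by
  refine completion_separated x fun n => ?_
  obtain ⟨s, y, rfl⟩ := exists_eq_algebraMap_add_nsmul x n
  have h1 : algebraMap S (AdicCompletion (Ideal.span {(p : S)}) S) (p * s) =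
      -(p ^ (n + 1) • y) := by
    rw [map_mul, map_natCast, eq_neg_iff_add_eq_zero, ← hx, nsmul_eq_mul, nsmul_eq_mul]
    push_cast
    ring
  have h2 := congrArg (AdicCompletion.evalₐ (Ideal.span {(p : S)}) (n + 1)) h1
  rw [AlgHom.commutes, map_neg, map_nsmul, nsmul_eq_mul, Nat.cast_pow,
    ← map_natCast (algebraMap S (S ⧸ Ideal.span {(p : S)} ^ (n + 1))), ← map_pow,
    Ideal.Quotient.algebraMap_eq, Ideal.Quotient.eq_zero_iff_mem.2
      (Ideal.pow_mem_pow (Ideal.mem_span_singleton_self _) _), zero_mul, neg_zero,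
    Ideal.Quotient.eq_zero_iff_mem, Ideal.span_singleton_pow, Ideal.mem_span_singleton] at h2
  obtain ⟨u, hu⟩ := h2
  obtain rfl : s = p ^ n * u := by
    rw [← sub_eq_zero]
    exact h _ (by rw [mul_sub, hu]; ring)
  refine ⟨algebraMap S _ u + y, ?_⟩
  rw [nsmul_add, nsmul_eq_mul _ (algebraMap S _ u), map_mul, map_pow, map_natCast, Nat.cast_pow]

variable {R : Type*} [CommRing R] [Algebra R S]

/-- Since p^n is a natural number, additivity alone makes a map p-adically continuous. -/
theorem addHom_mem_pow_smul_top (D : S →+ S) (n : ℕ) {x : S}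
    (hx : x ∈ (Ideal.span {(p : S)} ^ n • ⊤ : Ideal S)) :
    D x ∈ (Ideal.span {(p : S)} ^ n • ⊤ : Ideal S) := by
  rw [smul_eq_mul, Ideal.mul_top, Ideal.span_singleton_pow, Ideal.mem_span_singleton] at hx ⊢
  obtain ⟨y, rfl⟩ := hx
  refine ⟨D y, ?_⟩
  rw [← Nat.cast_pow, ← nsmul_eq_mul, map_nsmul, nsmul_eq_mul]

/-- An additive endomorphism modulo `p ^ n`. -/
def addHomModPow (D : S →+ S) (n : ℕ) : S ⧸ (Ideal.span {(p : S)} ^ n • ⊤ : Ideal S) →+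
    S ⧸ (Ideal.span {(p : S)} ^ n • ⊤ : Ideal S) :=
  QuotientAddGroup.map (Submodule.toAddSubgroup (Ideal.span {(p : S)} ^ n • ⊤ : Ideal S))
    (Submodule.toAddSubgroup (Ideal.span {(p : S)} ^ n • ⊤ : Ideal S)) D
    (fun _ hx => addHom_mem_pow_smul_top D n hx)

theorem addHomModPow_mk (D : S →+ S) (n : ℕ) (y : S) :
    addHomModPow (p := p) D n (Submodule.Quotient.mk y) = Submodule.Quotient.mk (D y) :=
  rfl

theorem transitionMap_quotientMk {m n : ℕ} (hmn : m ≤ n) (y : S) :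
    AdicCompletion.transitionMap (Ideal.span {(p : S)}) S hmn (Submodule.Quotient.mk y) =
      Submodule.Quotient.mk y :=
  Submodule.mapQ_apply _ _ _ _

theorem transitionMap_addHomModPow (D : S →+ S) {m n : ℕ} (hmn : m ≤ n)
    (z : S ⧸ (Ideal.span {(p : S)} ^ n • ⊤ : Ideal S)) :
    AdicCompletion.transitionMap (Ideal.span {(p : S)}) S hmn (addHomModPow D n z) =
      addHomModPow D m (AdicCompletion.transitionMap (Ideal.span {(p : S)}) S hmn z) := by
  obtain ⟨y, rfl⟩ := Submodule.Quotient.mk_surjective _ z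
  rw [addHomModPow_mk, transitionMap_quotientMk, transitionMap_quotientMk, addHomModPow_mk]

/-- The extension of an additive endomorphism to the `p`-adic completion. -/
def completionAddHom (D : S →+ S) :
    AdicCompletion (Ideal.span {(p : S)}) S →+ AdicCompletion (Ideal.span {(p : S)}) S where
  toFun x := ⟨fun n => addHomModPow D n (x.val n), fun {m n} hmn =>
    (transitionMap_addHomModPow D hmn (x.val n)).trans
      (congrArg (addHomModPow D m) (x.property hmn))⟩
  map_zero' := AdicCompletion.ext fun n => map_zero (addHomModPow D n)
  map_add' x y := AdicCompletion.ext fun n => map_add (addHomModPow D n) (x.val n) (y.val n)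

theorem completionAddHom_algebraMap (D : S →+ S) (s : S) :
    completionAddHom (p := p) D (algebraMap S _ s) = algebraMap S _ (D s) :=
  rfl

/-- The extension of a derivation to the `p`-adic completion. -/
def completionDer (D : Derivation R S S) :
    Derivation R (AdicCompletion (Ideal.span {(p : S)}) S)
      (AdicCompletion (Ideal.span {(p : S)}) S) :=
  Derivation.mk'
    { completionAddHom (D : S →+ S) with
      map_smul' := fun r x => by
        -- For fixed r both sides are additive in x, so by density the identity is checked on S.
        refine DFunLike.congr_fun (completion_addHom_ext completion_separated
          ((completionAddHom (D : S →+ S)).comp (DistribSMul.toAddMonoidHom _ r))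
          ((DistribSMul.toAddMonoidHom _ r).comp (completionAddHom (D : S →+ S))) fun s => ?_) x
        change completionAddHom (D : S →+ S) (algebraMap S _ (r • s)) =
          algebraMap S _ (r • D s)
        rw [completionAddHom_algebraMap]
        exact congrArg _ (D.map_smul r s) }
    (by
      -- The Leibniz rule is extended one argument at a time: here the first factor still lies in S,
      -- and the density argument is then repeated for that factor.
      have key : ∀ (s : S) (x : AdicCompletion (Ideal.span {(p : S)}) S),
          completionAddHom (D : S →+ S) (algebraMap S _ s * x) =
            algebraMap S _ s * completionAddHom (D : S →+ S) x + x * algebraMap S _ (D s) := by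
        intro s x
        refine DFunLike.congr_fun (completion_addHom_ext completion_separated
          ((completionAddHom (D : S →+ S)).comp (AddMonoidHom.mulLeft (algebraMap S _ s)))
          ((AddMonoidHom.mulLeft (algebraMap S _ s)).comp (completionAddHom (D : S →+ S)) +
            AddMonoidHom.mulRight (algebraMap S _ (D s))) fun u => ?_) x
        simp only [AddMonoidHom.comp_apply, AddMonoidHom.add_apply, AddMonoidHom.coe_mulLeft,
          AddMonoidHom.coe_mulRight, completionAddHom_algebraMap, ← map_mul, ← map_add]
        exact congrArg _ (D.leibniz s u)
      intro x y
      refine DFunLike.congr_fun (completion_addHom_ext completion_separated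
          ((completionAddHom (D : S →+ S)).comp (AddMonoidHom.mulRight y))
          ((AddMonoidHom.mulRight (completionAddHom (D : S →+ S) y)) +
            (AddMonoidHom.mulLeft y).comp (completionAddHom (D : S →+ S))) fun u => ?_) x
      exact key u y)

end Completion

/-! ### Conjugate derivations of jet algebras and jet rings -/

section QuotientDer

variable {R P : Type*} [CommRing R] [CommRing P] [Algebra R P]

/-- The derivation of `P ⧸ I` induced by a derivation of `P` that preserves `I`. -/
def quotientDer (I : Ideal P) (D : Derivation R P P) (h : ∀ x ∈ I, D x ∈ I) :
    Derivation R (P ⧸ I) (P ⧸ I) :=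
  Derivation.mk'
    { QuotientAddGroup.map I.toAddSubgroup I.toAddSubgroup (D : P →+ P) h with
      map_smul' := fun r x => by
        obtain ⟨x, rfl⟩ := Ideal.Quotient.mk_surjective x
        exact congrArg (Ideal.Quotient.mk I) (D.map_smul r x) }
    (by
      intro x y
      obtain ⟨x, rfl⟩ := Ideal.Quotient.mk_surjective x
      obtain ⟨y, rfl⟩ := Ideal.Quotient.mk_surjective y
      exact congrArg (Ideal.Quotient.mk I) (D.leibniz x y))

end QuotientDer

section JetDerivations

variable {p : ℕ} [Fact p.Prime] {R : Type*} [CommRing R] [FrobeniusBase p R]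
  {B B' : Type*} [CommRing B] [Algebra R B] [CommRing B'] [Algebra R B']

/-- The `j`-th conjugate derivation of the `n`-th term of the universal prolongation sequence. -/
def JetAlg.conjDer {e : R} (he : FrobeniusBase.unif p * e = p) (d : Derivation R B B) (n j : ℕ) :
    Derivation R (JetAlg p R B n) (JetAlg p R B n) :=
  quotientDer (jetIdeal p R B n) (JetPoly.conjDer p (FrobeniusBase.unif p) e d n j)
    (conjDer_mem_jetIdeal he d n j)

theorem JetAlg.conjDer_mk {e : R} (he : FrobeniusBase.unif p * e = p) (d : Derivation R B B)
    (n j : ℕ) (x : JetPoly R B n) : JetAlg.conjDer he d n j (JetAlg.mk p R B n x) =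
      JetAlg.mk p R B n (JetPoly.conjDer p (FrobeniusBase.unif p) e d n j x) :=
  rfl

theorem JetAlg.mk_surjective (n : ℕ) : Function.Surjective (JetAlg.mk p R B n) :=
  Ideal.Quotient.mk_surjective

theorem JetAlg.map_mk (h : B →ₐ[R] B') (n : ℕ) (x : JetPoly R B n) :
    JetAlg.map p h n (JetAlg.mk p R B n x) = JetAlg.mk p R B' n (JetPoly.map h n x) :=
  rfl

/-- The `j`-th conjugate derivation of the ring of functions of the `n`-th jet space. -/
def JetRing.conjDer {e : R} (he : FrobeniusBase.unif p * e = p) (d : Derivation R B B) (n j : ℕ) :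
    Derivation R (JetRing p R B n) (JetRing p R B n) :=
  completionDer (p := p) (JetAlg.conjDer he d n j)

theorem JetRing.conjDer_of {e : R} (he : FrobeniusBase.unif p * e = p) (d : Derivation R B B)
    (n j : ℕ) (x : JetAlg p R B n) : JetRing.conjDer he d n j (JetRing.of p R B n x) =
      JetRing.of p R B n (JetAlg.conjDer he d n j x) :=
  rfl

theorem JetRing.separated (n : ℕ) (x : JetRing p R B n)
    (hx : ∀ m, ∃ y : JetRing p R B n, x = p ^ m • y) : x = 0 :=
  completion_separated (p := p) (S := JetAlg p R B n) x hx

/-- Additive maps from a jet ring to a `p`-adically separated group are determined by their values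
on polynomials in `x, δ x, …, δⁿ x`. -/
theorem JetRing.addHom_ext {n : ℕ} {M : Type*} [AddCommGroup M]
    (hM : ∀ x : M, (∀ m, ∃ y : M, x = p ^ m • y) → x = 0) (F G : JetRing p R B n →+ M)
    (h : ∀ x, F (JetRing.of p R B n (JetAlg.mk p R B n x)) =
      G (JetRing.of p R B n (JetAlg.mk p R B n x))) : F = G := by
  refine completion_addHom_ext (p := p) (S := JetAlg p R B n) hM F G fun s => ?_
  obtain ⟨x, rfl⟩ := JetAlg.mk_surjective n s
  exact h x

theorem completionMap_algebraMap {S T : Type*} [CommRing S] [CommRing T] (f : S →+* T) (s : S) :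
    completionMap p f (algebraMap S _ s) = algebraMap T _ (f s) := by
  refine AdicCompletion.ext_evalₐ fun n => ?_
  rw [completionMap, AdicCompletion.evalₐ_liftRingHom, AlgHom.commutes, RingHom.comp_apply,
    RingHom.coe_coe, AlgHom.commutes]
  · rfl
  · exact fun hle => RingHom.ext fun x => factorPow_modPow p f hle x

theorem completionLift_algebraMap {S T : Type*} [CommRing S] [CommRing T]
    [IsAdicComplete (Ideal.span {(p : T)}) T] (f : S →+* T) (s : S) :
    completionLift p f (algebraMap S _ s) = f s := by
  rw [← sub_eq_zero]
  refine IsHausdorff.haus (I := Ideal.span {(p : T)}) inferInstance _ fun n => ?_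
  rw [SModEq.sub_mem, sub_zero, smul_eq_mul, Ideal.mul_top, ← Ideal.Quotient.eq_zero_iff_mem,
    map_sub, sub_eq_zero, completionLift, IsAdicComplete.mk_liftRingHom, RingHom.comp_apply,
    RingHom.coe_coe, AlgHom.commutes]
  · rfl
  · exact fun hle => RingHom.ext fun x => factorPow_modPow p f hle x

theorem JetRing.map_of (h : B →ₐ[R] B') (n : ℕ) (x : JetAlg p R B n) :
    JetRing.map p h n (JetRing.of p R B n x) = JetRing.of p R B' n (JetAlg.map p h n x) :=
  completionMap_algebraMap (JetAlg.map p h n : JetAlg p R B n →+* JetAlg p R B' n) x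

theorem JetRing.map_conjDer {e : R} (he : FrobeniusBase.unif p * e = p) {d : Derivation R B B}
    {d' : Derivation R B' B'} (h : B →ₐ[R] B') (hd : ∀ b, h (d b) = d' (h b)) (n j : ℕ)
    (x : JetRing p R B n) : JetRing.map p h n (JetRing.conjDer he d n j x) =
      JetRing.conjDer he d' n j (JetRing.map p h n x) := by
  refine DFunLike.congr_fun (JetRing.addHom_ext (JetRing.separated n)
    ((JetRing.map p h n : JetRing p R B n →+ JetRing p R B' n).comp
      (JetRing.conjDer he d n j : JetRing p R B n →+ JetRing p R B n))
    ((JetRing.conjDer he d' n j : JetRing p R B' n →+ JetRing p R B' n).comp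
      (JetRing.map p h n : JetRing p R B n →+ JetRing p R B' n)) fun z => ?_) x
  change JetRing.map p h n (JetRing.conjDer he d n j (JetRing.of p R B n (JetAlg.mk p R B n z))) =
    JetRing.conjDer he d' n j (JetRing.map p h n (JetRing.of p R B n (JetAlg.mk p R B n z)))
  rw [JetRing.conjDer_of, JetAlg.conjDer_mk, JetRing.map_of, JetRing.map_of, JetAlg.map_mk,
    JetAlg.map_mk, JetRing.conjDer_of, JetAlg.conjDer_mk, ArithJet.map_conjDer h hd]

theorem JetRing.conjDer_phiPow {e : R} (hu : (FrobeniusBase.unif p : R) = p)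
    (he : FrobeniusBase.unif p * e = p) (d : Derivation R B B) {r s : ℕ} (hs : s ≤ r) (j : ℕ)
    (b : B) : JetRing.conjDer he d r j (JetRing.phiPow p R r s b) =
      if s = j then (p : JetRing p R B r) ^ j * JetRing.phiPow p R r j (d b) else 0 := by
  rw [JetRing.phiPow, JetRing.conjDer_of, JetAlg.conjDer_mk,
    ArithJet.conjDer_phiPow hu he d b r j s hs]
  split_ifs with h
  · rw [JetRing.phiPow, map_mul, map_mul, map_pow, map_pow, map_natCast, map_natCast]
  · rw [map_zero, map_zero]

end JetDerivations

/-! ### The comparison map intertwines the conjugate derivations -/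

section CompareDer

variable {p : ℕ} [Fact p.Prime] {R : Type*} (R' : Type*) [CommRing R] [CommRing R'] [Algebra R R']
  [FrobeniusBase p R] [FrobeniusBase p R'] {A : Type*} [CommRing A] [Algebra R A]

/-- The distinguished element of R is p, so φ over R extends to φ over R' with t = p. Scalar
extension therefore respects every ingredient of the recursion. -/
theorem map_conjDer_algebraMap [FrobeniusExt p R R'] {e : R} {e' : R'}
    (he : algebraMap R R' e = e') (d : A → A) (n : ℕ) : ∀ (j : ℕ) (x : JetPoly R A n),
    MvPolynomial.map (algebraMap R R') (conjDer p (FrobeniusBase.unif p) e d n j x) =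
      conjDer p (p : R') e' d n j (MvPolynomial.map (algebraMap R R') x) := by
  have ext : ∀ n, (∀ (j : ℕ) (v : Fin (n + 1) × A),
      MvPolynomial.map (algebraMap R R') (conjDer p (FrobeniusBase.unif p) e d n j (X v)) =
        conjDer p (p : R') e' d n j (X v)) → ∀ (j : ℕ) (x : JetPoly R A n),
      MvPolynomial.map (algebraMap R R') (conjDer p (FrobeniusBase.unif p) e d n j x) =
        conjDer p (p : R') e' d n j (MvPolynomial.map (algebraMap R R') x) := by
    intro n hn j x
    induction x using MvPolynomial.induction_on with
    | C a => rw [conjDer_C, map_C, conjDer_C, map_zero]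
    | add f g hf hg => simp only [map_add, hf, hg]
    | mul_X f v hf =>
      rw [Derivation.leibniz, map_mul, Derivation.leibniz, ← hf, map_X, ← hn]
      simp
  induction n with
  | zero =>
    refine ext 0 ?_
    rintro (_ | j) v
    · rw [conjDer_zero_zero_X, conjDer_zero_zero_X, map_X]
    · exact map_zero _
  | succ n ih =>
    refine ext (n + 1) ?_
    rintro j ⟨k, b⟩
    induction k using Fin.lastCases with
    | last =>
      rw [conjDer_last, conjDer_last, map_sub, map_mul, map_mul, map_pow, map_C, he, map_X,
        ← incl_mixed, ih, map_X]
      congr 1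
      cases j with
      | zero => exact map_zero _
      | succ j =>
        simp only [frobConjDer]
        rw [← frob_mixed, ih, map_X]
    | cast k => rw [conjDer_castSucc, conjDer_castSucc, ← incl_mixed, ih, map_X]

theorem mixedProj_map (n : ℕ) (x : JetPoly R A n) :
    mixedProj p R R' A n (MvPolynomial.map (algebraMap R R') x) = 1 ⊗ₜ JetAlg.mk p R A n x := by
  have := mixedProj_algebraTensor p R R' A n (1 ⊗ₜ x)
  simpa using this

/-- The conjugate derivations of `R'[x, δ x, …, δⁿ x]` induce the `R'`-linear extensions of the
conjugate derivations of `Aⁿ`. -/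
theorem mixedProj_conjDer [FrobeniusExt p R R'] {e : R} (he : FrobeniusBase.unif p * e = p)
    {e' : R'} (he' : algebraMap R R' e = e') (d : Derivation R A A) (n j : ℕ)
    (x : JetPoly R' A n) : mixedProj p R R' A n (conjDer p (p : R') e' d n j x) =
      (JetAlg.conjDer he d n j : JetAlg p R A n →ₗ[R] JetAlg p R A n).baseChange R'
        (mixedProj p R R' A n x) := by
  rw [← derBaseChange_apply]
  induction x using MvPolynomial.induction_on with
  | C a =>
    rw [conjDer_C, map_zero, ← MvPolynomial.algebraMap_eq, AlgHom.commutes,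
      Derivation.map_algebraMap]
  | add f g hf hg => simp only [map_add, hf, hg]
  | mul_X f v hf =>
    have hX : mixedProj p R R' A n (conjDer p (p : R') e' d n j (X v)) =
        derBaseChange R' (JetAlg.conjDer he d n j) (mixedProj p R R' A n (X v)) := by
      -- A variable is already defined over R, where the conjugate derivation of Aⁿ is known by
      -- construction.
      rw [← MvPolynomial.map_X (algebraMap R R') v, ← map_conjDer_algebraMap R' he',
        mixedProj_map, mixedProj_map, derBaseChange_tmul, JetAlg.conjDer_mk]
    rw [Derivation.leibniz, map_mul, Derivation.leibniz, ← hf, ← hX]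
    simp

theorem compareAlg_mk [FrobeniusExt p R R'] (n : ℕ) (x : JetPoly R' (R' ⊗[R] A) n) :
    compareAlg p R R' A n (JetAlg.mk p R' (R' ⊗[R] A) n x) =
      mixedProj p R R' A n (comparePoly p R R' A n x) :=
  rfl

/-- The congruence modulo relations of `comparePoly_conjDer` becomes an equality in R' ⊗ Aⁿ. -/
theorem compareAlg_conjDer [FrobeniusExt p R R'] {e : R} (he : FrobeniusBase.unif p * e = p)
    {c : R'} (hc : FrobeniusBase.unif p * c = p) (hφ : FrobeniusBase.phi p c = c)
    (he' : algebraMap R R' e = 1) (d : Derivation R A A) (n j : ℕ)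
    (x : JetAlg p R' (R' ⊗[R] A) n) :
    compareAlg p R R' A n (c ^ j • JetAlg.conjDer hc (derBaseChange R' d) n j x) =
      (JetAlg.conjDer he d n j : JetAlg p R A n →ₗ[R] JetAlg p R A n).baseChange R'
        (compareAlg p R R' A n x) := by
  obtain ⟨x, rfl⟩ := JetAlg.mk_surjective n x
  have h := comparePoly_conjDer R' hc hφ d n j x
  rw [RingHom.mem_ker, map_sub, sub_eq_zero, mixedProj_conjDer R' he he'] at h
  rw [map_smul, JetAlg.conjDer_mk, compareAlg_mk, compareAlg_mk, ← h, map_mul, map_pow,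
    ← MvPolynomial.algebraMap_eq, AlgHom.commutes, ← map_pow, Algebra.smul_def]

theorem compare_of [FrobeniusExt p R R'] (n : ℕ) (x : JetAlg p R' (R' ⊗[R] A) n) :
    compare p R R' A n (JetRing.of p R' (R' ⊗[R] A) n x) =
      Algebra.TensorProduct.map (AlgHom.id R' R') (JetRing.of p R A n)
        (compareAlg p R R' A n x) :=
  completionLift_algebraMap _ x

/-- The comparison map intertwines `(p / ϖ) ^ j` times the `j`-th conjugate derivation of the
`ϖ`-jets with the `R'`-linear extension of the `j`-th conjugate derivation of the `p`-jets. -/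
theorem compare_conjDer [FrobeniusExt p R R'] {e : R} (he : FrobeniusBase.unif p * e = p)
    {c : R'} (hc : FrobeniusBase.unif p * c = p) (hφ : FrobeniusBase.phi p c = c)
    (he' : algebraMap R R' e = 1) (d : Derivation R A A) (n j : ℕ)
    (x : JetRing p R' (R' ⊗[R] A) n) :
    compare p R R' A n (c ^ j • JetRing.conjDer hc (derBaseChange R' d) n j x) =
      (JetRing.conjDer he d n j : JetRing p R A n →ₗ[R] JetRing p R A n).baseChange R'
        (compare p R R' A n x) := by
  -- The target is p-adically separated, so the two additive maps need only agree on polynomials.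
  have hsep := ((isAdicComplete_span_iff (p := p) (R' ⊗[R] JetRing p R A n)
    (R' ⊗[R] JetRing p R A n)).1 inferInstance).1
  refine DFunLike.congr_fun (JetRing.addHom_ext hsep
    ((compare p R R' A n : JetRing p R' (R' ⊗[R] A) n →+ R' ⊗[R] JetRing p R A n).comp
      ((c ^ j • JetRing.conjDer hc (derBaseChange R' d) n j :
        Derivation R' (JetRing p R' (R' ⊗[R] A) n) (JetRing p R' (R' ⊗[R] A) n)) :
          JetRing p R' (R' ⊗[R] A) n →+ JetRing p R' (R' ⊗[R] A) n))
    (((JetRing.conjDer he d n j : JetRing p R A n →ₗ[R] JetRing p R A n).baseChange R' :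
      R' ⊗[R] JetRing p R A n →+ R' ⊗[R] JetRing p R A n).comp
      (compare p R R' A n : JetRing p R' (R' ⊗[R] A) n →+ R' ⊗[R] JetRing p R A n))
    fun z => ?_) x
  have hz : ∀ y : R' ⊗[R] JetAlg p R A n,
      (JetRing.conjDer he d n j : JetRing p R A n →ₗ[R] JetRing p R A n).baseChange R'
        (Algebra.TensorProduct.map (AlgHom.id R' R') (JetRing.of p R A n) y) =
      Algebra.TensorProduct.map (AlgHom.id R' R') (JetRing.of p R A n)
        ((JetAlg.conjDer he d n j : JetAlg p R A n →ₗ[R] JetAlg p R A n).baseChange R' y) := by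
    intro y
    induction y using TensorProduct.induction_on with
    | zero => simp only [map_zero]
    | tmul r a => rfl
    | add y y' hy hy' => simp only [map_add, hy, hy']
  change compare p R R' A n (c ^ j • JetRing.conjDer hc (derBaseChange R' d) n j
      (JetRing.of p R' (R' ⊗[R] A) n (JetAlg.mk p R' (R' ⊗[R] A) n z))) =
    (JetRing.conjDer he d n j : JetRing p R A n →ₗ[R] JetRing p R A n).baseChange R'
      (compare p R R' A n (JetRing.of p R' (R' ⊗[R] A) n (JetAlg.mk p R' (R' ⊗[R] A) n z)))
  rw [JetRing.conjDer_of, ← map_smul, compare_of, compare_of, compareAlg_conjDer R' he hc hφ he',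
    hz]

end CompareDer

/-! ### Prolongation of substitutions -/

section Prolong

variable (p : ℕ) [Fact p.Prime] {S : Type*} [CommRing S] [FrobeniusBase p S] {ι κ : Type*}
  (σ : ι → JetPoly S κ 0)

/-- The element `δⁱ (σ a)` of `S[x, δ x, …, δⁿ x]`, for `i ≤ n`. -/
def prolongPow : ∀ n : ℕ, ℕ → ι → JetPoly S κ n
  | 0, _, a => σ a
  | n + 1, 0, a => incl S κ n (prolongPow n 0 a)
  | n + 1, i + 1, a => delta (p := p) (dvd_refl (FrobeniusBase.unif p : S)) n (prolongPow n i a)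

/-- The homomorphism of polynomial jet rings with `δⁱ x_a ↦ δⁱ (σ a)`. -/
def prolong (n : ℕ) : JetPoly S ι n →ₐ[S] JetPoly S κ n :=
  aeval (fun v => prolongPow p σ n v.1 v.2)

theorem prolong_X (n : ℕ) (v : Fin (n + 1) × ι) :
    prolong p σ n (X v) = prolongPow p σ n v.1 v.2 :=
  aeval_X _ _

theorem prolong_C (n : ℕ) (a : S) : prolong p σ n (C a) = C a :=
  aeval_C _ _

theorem prolongPow_castSucc (n : ℕ) : ∀ (i : ℕ), i ≤ n → ∀ (a : ι),
    prolongPow p σ (n + 1) i a = incl S κ n (prolongPow p σ n i a) := by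
  induction n with
  | zero =>
    intro i hi a
    obtain rfl : i = 0 := by omega
    rfl
  | succ n ih =>
    rintro (_ | i) hi a
    · rfl
    · change delta (p := p) (dvd_refl (FrobeniusBase.unif p : S)) (n + 1)
        (prolongPow p σ (n + 1) i a) = _
      rw [ih i (by omega), delta_incl]
      rfl

theorem prolong_incl (n : ℕ) (x : JetPoly S ι n) :
    prolong p σ (n + 1) (incl S ι n x) = incl S κ n (prolong p σ n x) := by
  have : (prolong p σ (n + 1)).comp (incl S ι n) = (incl S κ n).comp (prolong p σ n) := by
    ext v : 1
    simp only [AlgHom.comp_apply, incl_X, prolong_X]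
    exact prolongPow_castSucc p σ n v.1 (by omega) v.2
  exact DFunLike.congr_fun this x

theorem prolong_last (n : ℕ) (a : ι) : prolong p σ (n + 1) (X (Fin.last (n + 1), a)) =
    delta (p := p) (dvd_refl (FrobeniusBase.unif p : S)) n
      (prolong p σ n (X (Fin.last n, a))) := by
  rw [prolong_X, prolong_X]
  rfl

theorem prolong_frob (n : ℕ) (x : JetPoly S ι n) :
    prolong p σ (n + 1) (frob p ι (FrobeniusBase.unif p : S) n x) =
      frob p κ (FrobeniusBase.unif p : S) n (prolong p σ n x) := by
  induction x using MvPolynomial.induction_on with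
  | C a => rw [frob_C, prolong_C, prolong_C, frob_C]
  | add f g hf hg => simp only [map_add, hf, hg]
  | mul_X f v hf =>
    rw [map_mul, map_mul, map_mul, map_mul, hf]
    congr 1
    have h1 := unif_mul_delta (p := p) (dvd_refl (FrobeniusBase.unif p : S)) n
      (prolongPow p σ n v.1 v.2)
    have h2 : prolongPow p σ (n + 1) v.1.succ v.2 =
        delta (p := p) (dvd_refl (FrobeniusBase.unif p : S)) n (prolongPow p σ n v.1 v.2) := rfl
    rw [frob_X, map_add, map_pow, map_mul, prolong_C, ← incl_X, prolong_incl, prolong_X,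
      prolong_X, h2, h1]
    ring

/-- The substitution commutes with φ and with the inclusion, and ϖ can be cancelled. -/
theorem prolong_delta (n : ℕ) (x : JetPoly S ι n) :
    prolong p σ (n + 1) (delta (p := p) (dvd_refl (FrobeniusBase.unif p : S)) n x) =
      delta (p := p) (dvd_refl (FrobeniusBase.unif p : S)) n (prolong p σ n x) := by
  apply unif_cancel (p := p)
  rw [unif_mul_delta, ← prolong_frob, ← prolong_incl, ← map_pow, ← map_sub,
    ← unif_mul_delta (dvd_refl (FrobeniusBase.unif p : S)), map_mul, prolong_C]

end Prolong

/-! ### Jet algebras of smooth algebras -/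

section SmoothJets

variable {p : ℕ} [Fact p.Prime] {R : Type*} [CommRing R] [FrobeniusBase p R]
  {A : Type*} [CommRing A] [Algebra R A]

theorem delta_X_last (n : ℕ) (a : A) :
    delta (p := p) (dvd_refl (FrobeniusBase.unif p : R)) n (X (Fin.last n, a)) =
      X (Fin.last (n + 1), a) := by
  apply unif_cancel (p := p)
  rw [unif_mul_delta, frob_X, incl_X, add_sub_cancel_left, Fin.succ_last]

/-- With z = x − y one has δ(z + y) = δz + δy − (p/ϖ)·r·z·y, and both δz and z are relations. Hence
δ descends to a map Aⁿ → Aⁿ⁺¹. -/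
theorem delta_sub_delta_mem (n : ℕ) {x y : JetPoly R A n} (h : x - y ∈ jetIdeal p R A n) :
    delta (p := p) (dvd_refl (FrobeniusBase.unif p : R)) n x -
      delta (p := p) (dvd_refl (FrobeniusBase.unif p : R)) n y ∈ jetIdeal p R A (n + 1) := by
  obtain ⟨z, rfl⟩ : ∃ z, x = z + y := ⟨x - y, by ring⟩
  rw [add_sub_cancel_right] at h
  obtain ⟨r, hr⟩ := exists_add_pow_prime_eq (Fact.out : p.Prime) (incl R A n z) (incl R A n y)
  obtain ⟨c, hc⟩ := FrobeniusBase.unif_dvd (p := p) (R := R)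
  have hc' : ((p : ℕ) : JetPoly R A (n + 1)) = C (FrobeniusBase.unif p : R) * C c := by
    rw [← map_mul, ← hc, map_natCast]
  have : delta (p := p) (dvd_refl (FrobeniusBase.unif p : R)) n (z + y) -
      delta (p := p) (dvd_refl (FrobeniusBase.unif p : R)) n y =
        delta (p := p) (dvd_refl (FrobeniusBase.unif p : R)) n z -
          C c * incl R A n y * r * incl R A n z := by
    apply unif_cancel (p := p)
    have h1 := unif_mul_delta (p := p) (dvd_refl (FrobeniusBase.unif p : R)) n z
    have h2 := unif_mul_delta (p := p) (dvd_refl (FrobeniusBase.unif p : R)) n y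
    have h3 := unif_mul_delta (p := p) (dvd_refl (FrobeniusBase.unif p : R)) n (z + y)
    rw [map_add, map_add, hr, hc'] at h3
    linear_combination h3 - h1 - h2
  rw [this]
  exact Ideal.sub_mem _ (jetIdeal_delta n h) (Ideal.mul_mem_left _ _ (jetIdeal_incl n h))

theorem incl_mem_jetIdeal_sq (n : ℕ) {x : JetPoly R A n} (hx : x ∈ jetIdeal p R A n ^ 2) :
    incl R A n x ∈ jetIdeal p R A (n + 1) ^ 2 := by
  rw [pow_two] at hx ⊢
  induction hx using Submodule.mul_induction_on' with
  | mem_mul_mem u hu v hv =>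
    rw [map_mul]
    exact Ideal.mul_mem_mul (jetIdeal_incl n hu) (jetIdeal_incl n hv)
  | add x _ y _ hx hy => rw [map_add]; exact Ideal.add_mem _ hx hy

/-- In δ(uv) = φ(u)·δv + δu·v^p each term is a product of two relations when u and v are relations.
For sums, the correction term is a multiple of one summand and stays in the square. -/
theorem delta_mem_jetIdeal_sq (n : ℕ) {x : JetPoly R A n} (hx : x ∈ jetIdeal p R A n ^ 2) :
    delta (p := p) (dvd_refl (FrobeniusBase.unif p : R)) n x ∈ jetIdeal p R A (n + 1) ^ 2 := by
  rw [pow_two] at hx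
  induction hx using Submodule.mul_induction_on' with
  | mem_mul_mem u hu v hv =>
    have : delta (p := p) (dvd_refl (FrobeniusBase.unif p : R)) n (u * v) =
        frob p A (FrobeniusBase.unif p : R) n u *
          delta (p := p) (dvd_refl (FrobeniusBase.unif p : R)) n v +
        delta (p := p) (dvd_refl (FrobeniusBase.unif p : R)) n u * incl R A n v ^ p := by
      apply unif_cancel (p := p)
      have h1 := unif_mul_delta (p := p) (dvd_refl (FrobeniusBase.unif p : R)) n u
      have h2 := unif_mul_delta (p := p) (dvd_refl (FrobeniusBase.unif p : R)) n v
      have h3 := unif_mul_delta (p := p) (dvd_refl (FrobeniusBase.unif p : R)) n (u * v)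
      rw [map_mul, map_mul] at h3
      linear_combination h3 - frob p A (FrobeniusBase.unif p : R) n u * h2 - incl R A n v ^ p * h1
    rw [this, pow_two]
    exact Ideal.add_mem _ (Ideal.mul_mem_mul (jetIdeal_frob n hu) (jetIdeal_delta n hv))
      (Ideal.mul_mem_mul (jetIdeal_delta n hu)
        (Ideal.pow_mem_of_mem _ (jetIdeal_incl n hv) _ (Fact.out : p.Prime).pos))
  | add x hx' y _ hx hy =>
    exact delta_add_mem _ n _ hx (incl_mem_jetIdeal_sq n (by rwa [pow_two])) hy

/-- A substitution that maps relations of order zero to squares of relations does so for relations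
of all orders. -/
theorem prolong_mem_jetIdeal_sq {σ : A → JetPoly R A 0}
    (h : ∀ x ∈ jetIdeal p R A 0, prolong p σ 0 x ∈ jetIdeal p R A 0 ^ 2) (n : ℕ) :
    ∀ x ∈ jetIdeal p R A n, prolong p σ n x ∈ jetIdeal p R A n ^ 2 := by
  induction n with
  | zero => exact h
  | succ n ih =>
    suffices hle : jetIdeal p R A (n + 1) ≤
        (jetIdeal p R A (n + 1) ^ 2).comap (prolong p σ (n + 1)) from fun x hx => hle hx
    refine Ideal.span_le.2 ?_
    rintro _ (⟨y, hy, rfl⟩ | ⟨y, hy, rfl⟩)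
    · rw [SetLike.mem_coe, Ideal.mem_comap, prolong_incl]
      exact incl_mem_jetIdeal_sq n (ih y hy)
    · rw [SetLike.mem_coe, Ideal.mem_comap, prolong_delta]
      exact delta_mem_jetIdeal_sq n (ih y hy)

/-- If `σ a` and `x_a` agree in `A` for all `a`, then so do their prolongations in `Aⁿ`. -/
theorem mk_prolong {σ : A → JetPoly R A 0}
    (h : ∀ a, X (0, a) - σ a ∈ jetIdeal p R A 0) (n : ℕ) (x : JetPoly R A n) :
    JetAlg.mk p R A n (prolong p σ n x) = JetAlg.mk p R A n x := by
  have hX : ∀ (n : ℕ) (v : Fin (n + 1) × A), X v - prolong p σ n (X v) ∈ jetIdeal p R A n := by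
    intro n
    induction n with
    | zero =>
      rintro ⟨k, a⟩
      obtain rfl : k = 0 := Fin.ext (by omega)
      rw [prolong_X]
      exact h a
    | succ n ih =>
      rintro ⟨k, a⟩
      induction k using Fin.lastCases with
      | last =>
        rw [prolong_last, ← delta_X_last (p := p)]
        exact delta_sub_delta_mem n (ih (Fin.last n, a))
      | cast k =>
        rw [← incl_X n (k, a), prolong_incl, ← map_sub]
        exact jetIdeal_incl n (ih (k, a))
  have : (JetAlg.mk p R A n).comp (prolong p σ n) = JetAlg.mk p R A n := by
    ext v : 1
    exact (Ideal.Quotient.eq.2 (hX n v)).symm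
  exact DFunLike.congr_fun this x

/-- The terms of the universal prolongation sequence of a formally smooth algebra are formally
smooth. -/
theorem formallySmooth_jetAlg [Algebra.FormallySmooth R A] (n : ℕ) :
    Algebra.FormallySmooth R (JetAlg p R A n) := by
  -- Formal smoothness of A gives a section g of P/J² → A, where P = R[x_a : a ∈ A]. Any lift σ of g
  -- to P is a substitution whose prolongations will split the higher orders.
  obtain ⟨g, hg⟩ := (Algebra.FormallySmooth.iff_split_surjection
    (aeval (fun v => v.2) : JetPoly R A 0 →ₐ[R] A) (aeval_surjective R A)).1 inferInstance
  choose σ hσ using fun a => Ideal.Quotient.mk_surjective (g a)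
  have hσA : ∀ a, (aeval (fun v => v.2) : JetPoly R A 0 →ₐ[R] A) (σ a) = a := by
    intro a
    have := DFunLike.congr_fun hg a
    rw [AlgHom.comp_apply, ← hσ] at this
    exact this
  -- Modulo J² the substitution is evaluation in A followed by g, so it kills J.
  have h0 : ∀ x ∈ jetIdeal p R A 0, prolong p σ 0 x ∈ jetIdeal p R A 0 ^ 2 := by
    have key : (Ideal.Quotient.mkₐ R (RingHom.ker (aeval (fun v => v.2) :
        JetPoly R A 0 →ₐ[R] A).toRingHom ^ 2)).comp (prolong p σ 0) =
        g.comp (aeval (fun v => v.2)) := by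
      ext v : 1
      rw [AlgHom.comp_apply, AlgHom.comp_apply, prolong_X, aeval_X]
      exact hσ v.2
    intro x hx
    have hx' : (aeval (fun v => v.2) : JetPoly R A 0 →ₐ[R] A) x = 0 := hx
    have := DFunLike.congr_fun key x
    rw [AlgHom.comp_apply, AlgHom.comp_apply, hx', map_zero] at this
    exact Ideal.Quotient.eq_zero_iff_mem.1 this
  have h1 : ∀ a, X (0, a) - σ a ∈ jetIdeal p R A 0 := by
    intro a
    change (aeval (fun v => v.2) : JetPoly R A 0 →ₐ[R] A) (X (0, a) - σ a) = 0
    rw [map_sub, hσA, aeval_X, sub_self]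
  have hker : RingHom.ker (JetAlg.mk p R A n).toRingHom = jetIdeal p R A n := Ideal.mk_ker
  -- Mapping relations into their square, the prolonged substitution descends to a section of the
  -- square-zero extension of Aⁿ by J_n/J_n².
  refine Algebra.FormallySmooth.of_split (JetAlg.mk p R A n)
    (Ideal.Quotient.liftₐ (jetIdeal p R A n) ((Ideal.Quotient.mkₐ R
      (RingHom.ker (JetAlg.mk p R A n).toRingHom ^ 2)).comp (prolong p σ n)) ?_) ?_
  · intro x hx
    refine Ideal.Quotient.eq_zero_iff_mem.2 ?_
    rw [hker]
    exact prolong_mem_jetIdeal_sq h0 n x hx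
  · refine AlgHom.ext fun z => ?_
    obtain ⟨x, rfl⟩ := JetAlg.mk_surjective n z
    exact mk_prolong h1 n x

/-- The terms of the universal prolongation sequence of an algebra generated by `f (X i)`, for
`i ∈ κ`, are generated by the elements `δʲ (f (X i))`. -/
theorem mk_prolong_surjective {κ : Type*} (f : MvPolynomial κ R →ₐ[R] A)
    (hf : Function.Surjective f) (n : ℕ) : Function.Surjective
      ((JetAlg.mk p R A n).comp (prolong p (fun i => X (0, f (X i))) n)) := by
  set σ : κ → JetPoly R A 0 := fun i => X (0, f (X i))
  have hX : ∀ (n : ℕ) (v : Fin (n + 1) × A),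
      ∃ q : JetPoly R κ n, X v - prolong p σ n q ∈ jetIdeal p R A n := by
    intro n
    induction n with
    | zero =>
      rintro ⟨k, a⟩
      obtain rfl : k = 0 := Fin.ext (by omega)
      obtain ⟨q, rfl⟩ := hf a
      refine ⟨rename (fun i => (0, i)) q, ?_⟩
      have key : ((aeval (fun v => v.2) : JetPoly R A 0 →ₐ[R] A).comp (prolong p σ 0)).comp
          (rename (fun i => (0, i))) = f := by
        ext i
        simp only [AlgHom.comp_apply, rename_X, prolong_X]
        exact aeval_X _ _
      change (aeval (fun v => v.2) : JetPoly R A 0 →ₐ[R] A) _ = 0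
      rw [map_sub, aeval_X, sub_eq_zero]
      exact (DFunLike.congr_fun key q).symm
    | succ n ih =>
      rintro ⟨k, a⟩
      induction k using Fin.lastCases with
      | last =>
        obtain ⟨q, hq⟩ := ih (Fin.last n, a)
        -- If q represents δⁿa, then δq represents δⁿ⁺¹a, because δ respects congruence modulo
        -- relations.
        refine ⟨delta (p := p) (dvd_refl (FrobeniusBase.unif p : R)) n q, ?_⟩
        rw [prolong_delta, ← delta_X_last (p := p)]
        exact delta_sub_delta_mem n hq
      | cast k =>
        obtain ⟨q, hq⟩ := ih (k, a)
        refine ⟨incl R κ n q, ?_⟩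
        rw [← incl_X n (k, a), prolong_incl, ← map_sub]
        exact jetIdeal_incl n hq
  intro z
  obtain ⟨x, rfl⟩ := JetAlg.mk_surjective n z
  rw [← AlgHom.mem_range]
  induction x using MvPolynomial.induction_on with
  | C a =>
    exact ⟨C a, by rw [AlgHom.toRingHom_eq_coe, RingHom.coe_coe, AlgHom.comp_apply, prolong_C]⟩
  | add x y hx hy => rw [map_add]; exact add_mem hx hy
  | mul_X x v hx =>
    rw [map_mul]
    obtain ⟨q, hq⟩ := hX n v
    exact mul_mem hx ⟨q, (Ideal.Quotient.eq.2 hq).symm⟩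

/-- The tautological presentation has a variable for each element of A. Finitely many generators of
A and their iterated δ's already generate Aⁿ, and a formally smooth quotient of that Noetherian
polynomial ring is flat. -/
theorem flat_jetAlg [IsNoetherianRing R] [Algebra.Smooth R A] (n : ℕ) :
    Module.Flat R (JetAlg p R A n) := by
  obtain ⟨m, f, hf⟩ := (Algebra.FiniteType.iff_quotient_mvPolynomial'' (R := R) (S := A)).1
    inferInstance
  have := formallySmooth_jetAlg (p := p) (R := R) (A := A) n
  exact Algebra.FormallySmooth.flat_of_algHom_of_isNoetherianRing _
    (mk_prolong_surjective (p := p) f hf n)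

theorem jetRing_torsionFree [IsDomain R] [IsNoetherianRing R] [Algebra.Smooth R A]
    (hp : (p : R) ≠ 0) (n : ℕ) (x : JetRing p R A n) (hx : (p : JetRing p R A n) * x = 0) :
    x = 0 := by
  have := flat_jetAlg (p := p) (R := R) (A := A) n
  refine completion_torsionFree (p := p) (S := JetAlg p R A n) ?_ x hx
  intro s hs
  have := Module.Flat.isSMulRegular_of_isRegular (M := JetAlg p R A n)
    (IsRegular.of_ne_zero hp)
  refine this ?_
  simp only [smul_zero]
  rw [Algebra.smul_def, map_natCast]
  exact hs

end SmoothJets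

/-! ### Uniqueness of the conjugate operators -/

section Uniqueness

variable {p : ℕ} [Fact p.Prime] {R : Type*} [CommRing R] [FrobeniusBase p R] {B : Type*}

theorem incl_phiPow (b : B) (r : ℕ) : ∀ s ≤ r,
    incl R B r (JetPoly.phiPow p R r s b) = JetPoly.phiPow p R (r + 1) s b := by
  induction r with
  | zero =>
    intro s hs
    obtain rfl : s = 0 := by omega
    rfl
  | succ r ih =>
    rintro (_ | s) hs
    · rfl
    · change incl R B (r + 1) (frob p B _ r (JetPoly.phiPow p R r s b)) =
        frob p B _ (r + 1) (JetPoly.phiPow p R (r + 1) s b)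
      rw [← frob_incl, ih s (by omega)]

/-- A subring of `R[x, δ x, …, δʳ x]` that contains `R` and all `φˢ x_b`, and that is closed under
division by `p`, is the whole ring. -/
theorem mem_of_phiPow_mem (hu : (FrobeniusBase.unif p : R) = p) (r : ℕ) :
    ∀ (T : Subring (JetPoly R B r)), (∀ a, C a ∈ T) →
      (∀ s ≤ r, ∀ b, JetPoly.phiPow p R r s b ∈ T) →
      (∀ z, (p : JetPoly R B r) * z ∈ T → z ∈ T) → ∀ z, z ∈ T := by
  have ext : ∀ (r : ℕ) (T : Subring (JetPoly R B r)), (∀ a, C a ∈ T) → (∀ v, X v ∈ T) →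
      ∀ z, z ∈ T := by
    intro r T hC hX z
    induction z using MvPolynomial.induction_on with
    | C a => exact hC a
    | add x y hx hy => exact add_mem hx hy
    | mul_X x v hx => exact mul_mem hx (hX v)
  induction r with
  | zero =>
    intro T hC hφ _
    refine ext 0 T hC ?_
    rintro ⟨k, b⟩
    obtain rfl : k = 0 := Fin.ext (by omega)
    exact hφ 0 le_rfl b
  | succ r ih =>
    intro T hC hφ hp
    -- The preimages of T under the inclusion and under φ both inherit the hypotheses one order
    -- lower, so T contains both images.
    have h1 : ∀ z, incl R B r z ∈ T := ih (T.comap (incl R B r).toRingHom)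
      (fun a => show incl R B r (C a) ∈ T by rw [incl_C]; exact hC a)
      (fun s hs b => show incl R B r (JetPoly.phiPow p R r s b) ∈ T by
        rw [incl_phiPow b r s hs]; exact hφ s (by omega) b)
      (fun z hz => hp _ (by
        have hz' : incl R B r (p * z) ∈ T := hz
        rwa [map_mul, map_natCast] at hz'))
    have h2 : ∀ z, frob p B (FrobeniusBase.unif p : R) r z ∈ T :=
      ih (T.comap (frob p B (FrobeniusBase.unif p : R) r))
        (fun a => by rw [Subring.mem_comap, frob_C]; exact hC _)
        (fun s hs b => hφ (s + 1) (by omega) b)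
        (fun z hz => hp _ (by rwa [Subring.mem_comap, map_mul, map_natCast] at hz))
    refine ext (r + 1) T hC ?_
    rintro ⟨k, b⟩
    induction k using Fin.lastCases with
    | last =>
      apply hp
      -- This difference is p·δ^(r+1) x_b, and T is closed under division by p.
      have h3 := sub_mem (h2 (X (Fin.last r, b))) (pow_mem (h1 (X (Fin.last r, b))) p)
      rw [frob_X, incl_X, add_sub_cancel_left, hu, map_natCast, Fin.succ_last] at h3
      exact h3
    | cast k => exact incl_X (S := R) r (k, b) ▸ h1 (X (k, b))

variable [CommRing B] [Algebra R B]

/-- A derivation of a `p`-torsion free jet ring that vanishes on all `φˢ b` is zero. -/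
theorem derivation_eq_zero_of_phiPow (hu : (FrobeniusBase.unif p : R) = p) {r : ℕ}
    (htf : ∀ x : JetRing p R B r, (p : JetRing p R B r) * x = 0 → x = 0)
    (D : Derivation R (JetRing p R B r) (JetRing p R B r))
    (h : ∀ s ≤ r, ∀ b, D (JetRing.phiPow p R r s b) = 0) : D = 0 := by
  -- The polynomials whose class is killed by D; the absence of p-torsion makes T closed under
  -- division by p.
  let T : Subring (JetPoly R B r) :=
    { carrier := {z | D (JetRing.of p R B r (JetAlg.mk p R B r z)) = 0}
      mul_mem' := fun {x y} hx hy => by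
        simp only [Set.mem_ofPred_eq] at hx hy ⊢
        rw [map_mul, map_mul, Derivation.leibniz, hx, hy, smul_zero, smul_zero, add_zero]
      one_mem' := by simp only [Set.mem_ofPred_eq, map_one, Derivation.map_one_eq_zero]
      add_mem' := fun {x y} hx hy => by
        simp only [Set.mem_ofPred_eq] at hx hy ⊢
        rw [map_add, map_add, map_add, hx, hy, add_zero]
      zero_mem' := by simp only [Set.mem_ofPred_eq, map_zero]
      neg_mem' := fun {x} hx => by
        simp only [Set.mem_ofPred_eq] at hx ⊢
        rw [map_neg, map_neg, map_neg, hx, neg_zero] }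
  have hT : ∀ z, z ∈ T := by
    refine mem_of_phiPow_mem hu r T ?_ h ?_
    · intro a
      change D _ = 0
      rw [← MvPolynomial.algebraMap_eq, AlgHom.commutes, AlgHom.commutes,
        Derivation.map_algebraMap]
    · intro z hz
      have hz' : D (JetRing.of p R B r (JetAlg.mk p R B r (p * z))) = 0 := hz
      rw [map_mul, map_mul, map_natCast, map_natCast, Derivation.leibniz, Derivation.map_natCast,
        smul_zero, add_zero] at hz'
      exact htf _ hz'
  refine Derivation.ext fun x => ?_
  exact DFunLike.congr_fun (JetRing.addHom_ext (JetRing.separated r)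
    (D : JetRing p R B r →+ JetRing p R B r) 0 hT) x

end Uniqueness

/-! ### Compatibility of scalars and derivations with restriction -/

section Functoriality

theorem JetRing.map_algebraMap {p : ℕ} [Fact p.Prime] {R : Type*} [CommRing R] [FrobeniusBase p R]
    {B B' : Type*} [CommRing B] [Algebra R B] [CommRing B'] [Algebra R B'] (h : B →ₐ[R] B')
    (n : ℕ) (a : R) :
    JetRing.map p h n (algebraMap R (JetRing p R B n) a) = algebraMap R (JetRing p R B' n) a := by
  rw [← (JetRing.of p R B n).commutes, JetRing.map_of, AlgHom.commutes, AlgHom.commutes]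

theorem map_derBaseChange {R : Type*} (R' : Type*) [CommRing R] [CommRing R'] [Algebra R R']
    {A A' : Type*} [CommRing A] [Algebra R A] [CommRing A'] [Algebra R A'] {d : Derivation R A A}
    {d' : Derivation R A' A'} (h : A →ₐ[R] A') (hd : ∀ a, h (d a) = d' (h a)) (x : R' ⊗[R] A) :
    (Algebra.TensorProduct.map (AlgHom.id R' R') h : R' ⊗[R] A →ₐ[R'] R' ⊗[R] A')
        (derBaseChange R' d x) =
      derBaseChange R' d' (Algebra.TensorProduct.map (AlgHom.id R' R') h x) := by
  induction x using TensorProduct.induction_on with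
  | zero => simp only [map_zero]
  | add x y hx hy => simp only [map_add, hx, hy]
  | tmul r a =>
    rw [derBaseChange_tmul, Algebra.TensorProduct.map_tmul, Algebra.TensorProduct.map_tmul,
      derBaseChange_tmul, hd]

end Functoriality

/-! ### Conjugate operators on jet spaces of smooth schemes -/

section Global

variable {p : ℕ} [Fact p.Prime] {X : Scheme.{0}} {f : X ⟶ Spec (CommRingCat.of (Rp p))}

theorem unif_Rp : (FrobeniusBase.unif p : Rp p) = p := rfl

theorem unif_Rp_mul_one : (FrobeniusBase.unif p : Rp p) * 1 = p := mul_one _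

theorem smooth_sec [Smooth f] (U : X.affineOpens) : Algebra.Smooth (Rp p) (Sec f U) := by
  have h1 : (f.appLE ⊤ U.1 le_top).hom.Smooth := f.smooth_appLE (isAffineOpen_top _) U.2 le_top
  have h2 : ((f.appLE ⊤ U.1 le_top).hom.comp
      (Scheme.ΓSpecIso (CommRingCat.of (Rp p))).inv.hom : Rp p →+* Γ(X, U.1)).Smooth :=
    RingHom.Smooth.respectsIso.2 _
      (Scheme.ΓSpecIso (CommRingCat.of (Rp p))).symm.commRingCatIsoToRingEquiv h1
  exact h2

theorem pJet_torsionFree [Smooth f] (r : ℕ) (U : X.affineOpens) (x : PJet f r U)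
    (hx : (p : PJet f r U) * x = 0) : x = 0 := by
  have := smooth_sec (f := f) U
  exact jetRing_torsionFree (WittVector.irreducible p).ne_zero r x hx

/-- The conjugate operators of a derivation of the structure sheaf. -/
def SheafDer.conj (d : SheafDer f) (r j : ℕ) : JetDer f r where
  der U := JetRing.conjDer unif_Rp_mul_one (d.der U) r j
  res_der U V h := JetRing.map_conjDer unif_Rp_mul_one (Sec.res f h) (d.res_der U V h) r j

theorem SheafDer.isConjugate_conj (d : SheafDer f) (r : ℕ) :
    IsConjugate d fun j : Fin (r + 1) => d.conj r j := by
  intro U j a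
  constructor
  · intro s hs
    refine (JetRing.conjDer_phiPow unif_Rp unif_Rp_mul_one (d.der U)
      (Nat.lt_succ_iff.1 s.2) j a).trans (if_neg ?_)
    exact fun h => hs (Fin.ext h)
  · exact (JetRing.conjDer_phiPow unif_Rp unif_Rp_mul_one (d.der U)
      (Nat.lt_succ_iff.1 j.2) j a).trans (if_pos rfl)

theorem JetDer.ext_der {r : ℕ} {D D' : JetDer f r} (h : ∀ U, D.der U = D'.der U) : D = D' := by
  cases D
  cases D'
  congr
  exact funext h

/-- The defining conditions prescribe the values on all φ^s(a), so the difference of two solutions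
is a derivation that vanishes there, hence zero. -/
theorem IsConjugate.unique [Smooth f] {d : SheafDer f} {r : ℕ} {D D' : Fin (r + 1) → JetDer f r}
    (hD : IsConjugate d D) (hD' : IsConjugate d D') : D = D' := by
  funext j
  refine JetDer.ext_der fun U => ?_
  rw [← sub_eq_zero]
  refine derivation_eq_zero_of_phiPow unif_Rp (pJet_torsionFree r U) _ fun s hs a => ?_
  rw [Derivation.sub_apply, sub_eq_zero]
  by_cases hsj : s = j
  · subst hsj
    rw [(hD U j a).2, (hD' U j a).2]
  · have hne : (⟨s, Nat.lt_succ_iff.2 hs⟩ : Fin (r + 1)) ≠ j := fun h => hsj (congrArg Fin.val h)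
    exact ((hD U j a).1 _ hne).trans ((hD' U j a).1 _ hne).symm

/-- Here c = p/π. It is fixed by φ because p and π are, and π can be cancelled. -/
theorem exists_unif_mul_eq (E : EisensteinPoly p) : ∃ c : Rpi E,
    FrobeniusBase.unif p * c = p ∧ FrobeniusBase.phi p c = c := by
  obtain ⟨c, hc⟩ := Rpi.pi_dvd E
  refine ⟨c, hc.symm, ?_⟩
  have h := congrArg (Rpi.phi E) hc
  rw [map_natCast, map_mul, Rpi.phi_pi, hc] at h
  exact ((mul_cancel_left_mem_nonZeroDivisors (Rpi.pi_mem E)).1 h).symm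

/-- The `R_π`-linear extensions of the conjugate operators preserve the image of the ring of
functions of the `π`-jet space. -/
theorem SheafDer.exists_conj_toPJet (d : SheafDer f) (E : EisensteinPoly p) (r j : ℕ)
    (g : PiFun f E r) : ∃ h : PiFun f E r, ∀ U : X.affineOpens,
      (d.conj r j).ext E U (toPJet f E r U (g.1 U)) = toPJet f E r U (h.1 U) := by
  obtain ⟨c, hc, hφ⟩ := exists_unif_mul_eq E
  -- The witness is c^j·∂_j^π g; its local pieces glue by naturality of the conjugate derivations.
  refine ⟨⟨fun U => algebraMap (Rpi E) _ (c ^ j) *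
    JetRing.conjDer hc (derBaseChange (Rpi E) (d.der U)) r j (g.1 U), ?_⟩, fun U => ?_⟩
  · intro U V h
    have hd := map_derBaseChange (Rpi E) (Sec.res f h) (d.res_der U V h)
    rw [map_mul]
    congr 1
    · exact JetRing.map_algebraMap _ r (c ^ j)
    · rw [← g.2 U V h]
      exact JetRing.map_conjDer hc _ hd r j (g.1 V)
  · have := compare_conjDer (Rpi E) unif_Rp_mul_one hc hφ (map_one _) (d.der U) r j (g.1 U)
    rw [Algebra.smul_def] at this
    exact this.symm

/-- The trace acts on the factor R_π and takes values in R_p, over which the derivation is linear.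
-/
theorem traceMap_ext {r : ℕ} (D : JetDer f r) (E : EisensteinPoly p) (U : X.affineOpens)
    (x : Rpi E ⊗[Rp p] PJet f r U) :
    traceMap f E r U (D.ext E U x) = D.der U (traceMap f E r U x) := by
  induction x using TensorProduct.induction_on with
  | zero => simp only [map_zero]
  | add x y hx hy => simp only [map_add, hx, hy]
  | tmul a x =>
    change Algebra.trace (Rp p) (Rpi E) a • D.der U x =
      D.der U (Algebra.trace (Rp p) (Rpi E) a • x)
    rw [Derivation.map_smul]

theorem derivation_natCast_pow_mul {R A : Type*} [CommRing R] [CommRing A] [Algebra R A]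
    (D : Derivation R A A) (m k : ℕ) (x : A) : D ((m : A) ^ k * x) = (m : A) ^ k * D x := by
  rw [← Nat.cast_pow, ← nsmul_eq_mul, map_nsmul, nsmul_eq_mul]

theorem SheafDer.isOverconvergent_conj (d : SheafDer f) (E : EisensteinPoly p) {r : ℕ} (j : ℕ)
    {s : PFun f r} (hs : IsOverconvergent f E r s) :
    IsOverconvergent f E r ((d.conj r j).app s) := by
  obtain ⟨ν, g, hg⟩ := hs
  obtain ⟨h, hh⟩ := d.exists_conj_toPJet E r j g
  -- The exponent ν does not change, since a derivation commutes with multiplication by p^ν.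
  refine ⟨ν, h, fun U => ?_⟩
  rw [← hh, hg]
  change 1 ⊗ₜ (d.conj r j).der U _ = 1 ⊗ₜ (_ * (d.conj r j).der U _)
  rw [derivation_natCast_pow_mul]

theorem SheafDer.isTraceOverconvergent_conj (d : SheafDer f) (E : EisensteinPoly p) {r : ℕ}
    (j : ℕ) {s : PFun f r} (hs : IsTraceOverconvergent f E r s) :
    IsTraceOverconvergent f E r ((d.conj r j).app s) := by
  obtain ⟨ν, g, hg⟩ := hs
  obtain ⟨h, hh⟩ := d.exists_conj_toPJet E r j g
  refine ⟨ν, h, fun U => ?_⟩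
  rw [← hh, traceMap_ext, hg, derivation_natCast_pow_mul]
  rfl

end Global

end ArithJet

end

theorem proposition2p11 (p : ℕ) [Fact p.Prime] (hp : 5 ≤ p) (E : ArithJet.EisensteinPoly p)
    {X : Scheme.{0}} (f : X ⟶ Spec (CommRingCat.of (ArithJet.Rp p))) [Smooth f]
    (d : ArithJet.SheafDer f) :
    (∀ r : ℕ,
      (∃! D : Fin (r + 1) → ArithJet.JetDer f r, ArithJet.IsConjugate d D) ∧
      ∀ D : Fin (r + 1) → ArithJet.JetDer f r, ArithJet.IsConjugate d D →
        ∀ (s : ArithJet.PFun f r) (j : Fin (r + 1)),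
          (ArithJet.IsOverconvergent f E r s →
            ArithJet.IsOverconvergent f E r ((D j).app s)) ∧
          (ArithJet.IsTraceOverconvergent f E r s →
            ArithJet.IsTraceOverconvergent f E r ((D j).app s))) ∧
    (∀ D : Fin 2 → ArithJet.JetDer f 1, ArithJet.IsConjugate d D →
      ∀ (j : Fin 2) (g : ArithJet.PiFun f E 1), ∃ h : ArithJet.PiFun f E 1,
        ∀ U : X.affineOpens,
          (D j).ext E U (ArithJet.toPJet f E 1 U (g.1 U)) =
            ArithJet.toPJet f E 1 U (h.1 U)) := by
  refine ⟨fun r => ⟨⟨_, d.isConjugate_conj r, fun D hD => hD.unique (d.isConjugate_conj r)⟩, ?_⟩,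
    ?_⟩
  · intro D hD s j
    -- By uniqueness an arbitrary system of conjugate operators is the constructed one, for which
    -- stability is known.
    obtain rfl := hD.unique (d.isConjugate_conj r)
    exact ⟨d.isOverconvergent_conj E j, d.isTraceOverconvergent_conj E j⟩
  · intro D hD j g
    obtain rfl := hD.unique (d.isConjugate_conj 1)
    exact d.exists_conj_toPJet E 1 j g
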